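/- Let $\Delta$ be the nearest-neighbor discrete Laplacian on $\mathbb Z^d$, $(\Delta\psi)(x)=\sum_{|y-x|=1}(\psi(y)-\psi(x))$, and let $H_\omega=-\Delta+\lambda V_\omega$ on $\ell^2(\mathbb Z^d)$, $\lambda>0$, where the site values $V_\omega(x)$, $x\in\mathbb Z^d$, are independent identically distributed random variables whose common distribution has a bounded density with compact support. For $\Lambda\subset\mathbb Z^d$ let $H_{\Lambda;\omega}$ be the restriction $P_\Lambda H_\omega P_\Lambda$ of $H_\omega$ to $\ell^2(\Lambda)$. For finite $\Lambda$ let $\Gamma(\Lambda)$ be the set of nearest-neighbor bonds $\langle u,u'\rangle$ with $u\in\Lambda$ and $u'\in\mathbb Z^d\setminus\Lambda$. Write $\mathbb E$ for the expectation with respect to the potential, and fix $0<s<1$. Let $E\in\mathbb R$, and suppose that there are $A<\infty$ and $\mu>0$ such that $$\mathbb E\Big(\big|\langle x|\tfrac{1}{H_\omega-E-i\eta}|y\rangle\big|^s\Big)\le A\,e^{-\mu|x-y|}\qquad\text{for all }x,y\in\mathbb Z^d\text{ and all real }\eta\neq0 .$$ Then for every constant $C_s<\infty$ there is an $L_0<\infty$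 such that for every integer $L\ge L_0$, with $\Lambda=[-L,L]^d\cap\mathbb Z^d$, $$\Big(1+\frac{C_s}{\lambda^s}|\Gamma(\Lambda)|\Big)^2\sum_{\langle u,u'\rangle\in\Gamma(\Lambda)}\mathbb E\Big(\big|\langle 0|\tfrac{1}{H_{\Lambda;\omega}-E}|u\rangle\big|^s\Big)<1 .$$ The same holds for $E\in\mathbb C\setminus\mathbb R$, where only the bound at $\eta=0$ is assumed. -/

import Mathlib

open MeasureTheory ProbabilityTheory
open scoped ENNReal NNReal

noncomputable section

/-- The sites of the lattice `ℤ^d`. -/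
abbrev Site (d : ℕ) : Type := Fin d → ℤ

/-- The unit lattice vectors: `a ∈ ℤ^d` with `∑ |a_j| = 1`. Two sites `x`, `y` are nearest
neighbours when `y - x` is one of them. -/
def unitSteps (d : ℕ) : Finset (Site d) :=
  {a ∈ Finset.Icc (-1 : Site d) 1 | ∑ j, |a j| = 1}

/-- Euclidean distance on `ℤ^d`. -/
def siteDist {d : ℕ} (x y : Site d) : ℝ := Real.sqrt (∑ j, ((x j : ℝ) - (y j : ℝ)) ^ 2)

/-- The cube `[-L, L]^d` in `ℤ^d`. -/
def cube (d L : ℕ) : Finset (Site d) := Finset.Icc (fun _ => -(L : ℤ)) (fun _ => (L : ℤ))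

/-- The bonds `⟨u, u'⟩` between nearest neighbours `u ∈ Λ` and `u' ∉ Λ`, each listed once, with
the endpoint in `Λ` first. -/
def boundaryBonds {d : ℕ} (Λ : Finset (Site d)) : Finset (Site d × Site d) :=
  ((Λ ×ˢ unitSteps d).image fun p => (p.1, p.1 + p.2)).filter fun b => b.2 ∉ Λ

/-- The Hilbert space `ℓ²(Λ)` of a region `Λ ⊆ ℤ^d`. -/
abbrev EllTwo {d : ℕ} (Λ : Set (Site d)) : Type := lp (fun _ : Λ => ℂ) 2

open Classical in
/-- Extension by zero of a function on `Λ` to `ℤ^d`. -/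
def extendZero {d : ℕ} {Λ : Set (Site d)} (ψ : Λ → ℂ) (y : Site d) : ℂ :=
  if h : y ∈ Λ then ψ ⟨y, h⟩ else 0

theorem summable_shift {d : ℕ} {Λ : Set (Site d)} (a : Site d) (ψ : EllTwo Λ) :
    Summable (fun x : Λ => ‖extendZero ψ ((x : Site d) + a)‖ ^ (2 : ℝ≥0∞).toReal) ∧
      ∑' x : Λ, ‖extendZero ψ ((x : Site d) + a)‖ ^ (2 : ℝ≥0∞).toReal
        ≤ ‖ψ‖ ^ (2 : ℝ≥0∞).toReal := by
  have key : ∀ t : Finset Λ,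
      ∑ x ∈ t, ‖extendZero ψ ((x : Site d) + a)‖ ^ (2 : ℝ≥0∞).toReal
        ≤ ‖ψ‖ ^ (2 : ℝ≥0∞).toReal := by
    intro t
    classical
    have h2 : (0 : ℝ) < (2 : ℝ≥0∞).toReal := by norm_num
    have h1 : ∑ x ∈ t, ‖extendZero ψ ((x : Site d) + a)‖ ^ (2 : ℝ≥0∞).toReal
        = ∑ x ∈ t.filter (fun x : Λ => (x : Site d) + a ∈ Λ),
            ‖extendZero ψ ((x : Site d) + a)‖ ^ (2 : ℝ≥0∞).toReal := by
      symm
      apply Finset.sum_subset (Finset.filter_subset _ _)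
      intro x hx hx'
      have hn : (x : Site d) + a ∉ Λ := fun hc => hx' (Finset.mem_filter.2 ⟨hx, hc⟩)
      simp [extendZero, hn]
    rw [h1, ← Finset.sum_attach]
    let σ : {x // x ∈ t.filter (fun x : Λ => (x : Site d) + a ∈ Λ)} → Λ :=
      fun x => ⟨(x.1 : Site d) + a, (Finset.mem_filter.1 x.2).2⟩
    have hσ : Function.Injective σ := by
      intro x y hxy
      have h := congrArg Subtype.val hxy
      exact Subtype.ext (Subtype.ext (add_right_cancel h))
    have h3 : ∀ x ∈ (t.filter (fun x : Λ => (x : Site d) + a ∈ Λ)).attach,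
        ‖extendZero ψ (((x : Λ) : Site d) + a)‖ ^ (2 : ℝ≥0∞).toReal
          = ‖ψ (σ x)‖ ^ (2 : ℝ≥0∞).toReal := by
      intro x _
      have hm : ((x : Λ) : Site d) + a ∈ Λ := (Finset.mem_filter.1 x.2).2
      simp [extendZero, hm, σ]
    rw [Finset.sum_congr rfl h3,
      ← Finset.sum_image (f := fun y : Λ => ‖ψ y‖ ^ (2 : ℝ≥0∞).toReal)
        (fun x _ y _ h => hσ h)]
    exact lp.sum_rpow_le_norm_rpow h2 ψ _
  have hs := summable_of_sum_le
    (f := fun x : Λ => ‖extendZero ψ ((x : Site d) + a)‖ ^ (2 : ℝ≥0∞).toReal)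
    (fun x => by positivity) key
  exact ⟨hs, hs.tsum_le_of_sum_le key⟩

/-- The shift `(S_a ψ)(x) = ψ(x + a)` compressed to `ℓ²(Λ)`: the value is `0` if `x + a ∉ Λ`. -/
def shiftOp {d : ℕ} (Λ : Set (Site d)) (a : Site d) : EllTwo Λ →L[ℂ] EllTwo Λ :=
  LinearMap.mkContinuous
    { toFun := fun ψ => ⟨fun x => extendZero ψ ((x : Site d) + a),
        memℓp_gen (summable_shift a ψ).1⟩
      map_add' := by
        intro ψ φ
        ext x
        change extendZero (⇑(ψ + φ)) ((x : Site d) + a)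
          = extendZero (⇑ψ) ((x : Site d) + a) + extendZero (⇑φ) ((x : Site d) + a)
        by_cases h : (x : Site d) + a ∈ Λ <;> simp [extendZero, h]
      map_smul' := by
        intro c ψ
        ext x
        by_cases h : (x : Site d) + a ∈ Λ <;> simp [extendZero, h] }
    1 (fun ψ => by
      rw [one_mul]
      exact lp.norm_le_of_tsum_le (by norm_num) (norm_nonneg _) (summable_shift a ψ).2)

theorem summable_mul_bounded {d : ℕ} {Λ : Set (Site d)} {v : Site d → ℝ} {M : ℝ} (hM : 0 ≤ M)
    (h : ∀ x ∈ Λ, |v x| ≤ M) (ψ : EllTwo Λ) :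
    Summable (fun x : Λ => ‖(v x : ℂ) * ψ x‖ ^ (2 : ℝ≥0∞).toReal) ∧
      ∑' x : Λ, ‖(v x : ℂ) * ψ x‖ ^ (2 : ℝ≥0∞).toReal
        ≤ (M * ‖ψ‖) ^ (2 : ℝ≥0∞).toReal := by
  have key : ∀ t : Finset Λ,
      ∑ x ∈ t, ‖(v x : ℂ) * ψ x‖ ^ (2 : ℝ≥0∞).toReal ≤ (M * ‖ψ‖) ^ (2 : ℝ≥0∞).toReal := by
    intro t
    have h2 : (0 : ℝ) < (2 : ℝ≥0∞).toReal := by norm_num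
    rw [Real.mul_rpow hM (norm_nonneg _)]
    refine le_trans ?_ (mul_le_mul_of_nonneg_left (lp.sum_rpow_le_norm_rpow h2 ψ t)
      (by positivity))
    rw [Finset.mul_sum]
    refine Finset.sum_le_sum fun x _ => ?_
    rw [← Real.mul_rpow hM (norm_nonneg _)]
    refine Real.rpow_le_rpow (norm_nonneg _) ?_ h2.le
    rw [norm_mul, Complex.norm_real, Real.norm_eq_abs]
    exact mul_le_mul_of_nonneg_right (h x x.2) (norm_nonneg _)
  have hs := summable_of_sum_le
    (f := fun x : Λ => ‖(v x : ℂ) * ψ x‖ ^ (2 : ℝ≥0∞).toReal)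
    (fun x => by positivity) key
  exact ⟨hs, hs.tsum_le_of_sum_le key⟩

/-- Multiplication by a potential `v` whose absolute value is bounded by `M` on `Λ`. -/
def mulOpOfBound {d : ℕ} (Λ : Set (Site d)) (v : Site d → ℝ) (M : ℝ) (hM : 0 ≤ M)
    (h : ∀ x ∈ Λ, |v x| ≤ M) : EllTwo Λ →L[ℂ] EllTwo Λ :=
  LinearMap.mkContinuous
    { toFun := fun ψ => ⟨fun x => (v x : ℂ) * ψ x, memℓp_gen (summable_mul_bounded hM h ψ).1⟩
      map_add' := by
        intro ψ φ
        ext x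
        change (v x : ℂ) * (ψ + φ) x = (v x : ℂ) * ψ x + (v x : ℂ) * φ x
        simp [mul_add]
      map_smul' := by
        intro c ψ
        ext x
        simp [mul_left_comm] }
    M (fun ψ => lp.norm_le_of_tsum_le (by norm_num) (by positivity)
      (summable_mul_bounded hM h ψ).2)

open Classical in
/-- Multiplication by the potential `v` on `ℓ²(Λ)`, as a bounded operator. It is set to `0` when
`v` is unbounded on `Λ`; this never happens for finite `Λ`, and for the whole lattice it is an
event of probability `0` under a regular distribution. -/
def mulOp {d : ℕ} (Λ : Set (Site d)) (v : Site d → ℝ) : EllTwo Λ →L[ℂ] EllTwo Λ :=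
  if h : ∃ M : ℝ, 0 ≤ M ∧ ∀ x ∈ Λ, |v x| ≤ M then
    mulOpOfBound Λ v h.choose h.choose_spec.1 h.choose_spec.2
  else 0

/-- The compression `P_Λ H P_Λ` to `ℓ²(Λ)` of the discrete Schrödinger operator
`H = -Δ + lam * v`, where `(-Δ ψ)(x) = ∑_{y nearest neighbour of x} (ψ(x) - ψ(y))`. -/
def schrodingerOp {d : ℕ} (Λ : Set (Site d)) (lam : ℝ) (v : Site d → ℝ) :
    EllTwo Λ →L[ℂ] EllTwo Λ :=
  ∑ a ∈ unitSteps d, (1 - shiftOp Λ a) + (lam : ℂ) • mulOp Λ v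

open Classical in
/-- The Green function `⟨x| (H_Λ - z)⁻¹ |y⟩`, extended by `0` outside `Λ`. -/
def green {d : ℕ} (Λ : Set (Site d)) (lam : ℝ) (v : Site d → ℝ) (z : ℂ) (x y : Site d) : ℂ :=
  if h : x ∈ Λ ∧ y ∈ Λ then
    (Ring.inverse (schrodingerOp Λ lam v - algebraMap ℂ (EllTwo Λ →L[ℂ] EllTwo Λ) z)
      (lp.single 2 (⟨y, h.2⟩ : Λ) (1 : ℂ))) ⟨x, h.1⟩
  else 0

/-- A random potential with regular distribution: the values at the sites are independent and
identically distributed, with a bounded density of compact support. -/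
structure IsRegularPotential {d : ℕ} {Ω : Type*} [MeasurableSpace Ω] (P : Measure Ω)
    (V : Site d → Ω → ℝ) : Prop where
  measurable : ∀ x, Measurable (V x)
  indep : iIndepFun V P
  density : ∃ ρ : ℝ → ℝ≥0, Measurable ρ ∧ (∃ M : ℝ≥0, ∀ t, ρ t ≤ M) ∧ HasCompactSupport ρ ∧
    ∀ x, P.map (V x) = volume.withDensity (fun t => (ρ t : ℝ≥0∞))

/-- The fractional moment `𝔼 |⟨x| (H_{Λ;ω} - z)⁻¹ |y⟩|^s`, in `[0, ∞]`. -/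
def fracMoment {d : ℕ} {Ω : Type*} [MeasurableSpace Ω] (P : Measure Ω) (V : Site d → Ω → ℝ)
    (lam s : ℝ) (Λ : Set (Site d)) (z : ℂ) (x y : Site d) : ℝ≥0∞ :=
  ∫⁻ ω, ‖green Λ lam (fun w => V w ω) z x y‖ₑ ^ s ∂P

/-- Exponential decay of the fractional moments of the Green function on the whole lattice at the
energy `E`, with amplitude `A` and rate `μ`. For real `E` the bound holds at `E + iη`, uniformly
in `η ≠ 0`; for `E` off the real axis, where the resolvent exists, it is the bound at `E`. -/
def FractionalMomentBound {d : ℕ} {Ω : Type*} [MeasurableSpace Ω] (P : Measure Ω)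
    (V : Site d → Ω → ℝ) (lam s : ℝ) (E : ℂ) (A μ : ℝ) : Prop :=
  (E.im = 0 → ∀ η : ℝ, η ≠ 0 → ∀ x y : Site d,
    fracMoment P V lam s Set.univ (E + η * Complex.I) x y
      ≤ ENNReal.ofReal (A * Real.exp (-μ * siteDist x y))) ∧
  (E.im ≠ 0 → ∀ x y : Site d,
    fracMoment P V lam s Set.univ E x y
      ≤ ENNReal.ofReal (A * Real.exp (-μ * siteDist x y)))

/-- The finite-volume criterion in the finite region `Λ` at the energy `E`, with constant `C`:
`(1 + (C / lam^s) |Γ(Λ)|)^2 ∑_{⟨u,u'⟩ ∈ Γ(Λ)} 𝔼 |⟨0| (H_{Λ;ω} - E)⁻¹ |u⟩|^s < 1`. -/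
def FiniteVolumeCriterion {d : ℕ} {Ω : Type*} [MeasurableSpace Ω] (P : Measure Ω)
    (V : Site d → Ω → ℝ) (lam s C : ℝ) (E : ℂ) (Λ : Finset (Site d)) : Prop :=
  ENNReal.ofReal ((1 + C / lam ^ s * ((boundaryBonds Λ).card : ℝ)) ^ 2) *
    ∑ b ∈ boundaryBonds Λ, fracMoment P V lam s (Λ : Set (Site d)) E 0 b.1 < 1

end

/-! Off the real axis, the geometric resolvent identity `green_finset_eq` writes the Green function
of the cube as the infinite-volume one minus a sum, over boundary bonds, of products of an
infinite-volume and a finite-volume Green function. From the origin, the infinite-volume factor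
always reaches at least distance `L`, so its `s`-moment is at most a constant times `exp (-μ L)`.
The two factors are dependent, so they are separated by Cauchy-Schwarz at exponent `s / 2`, where
`|·|^(s/2)` is also subadditive. This yields decay of the `s / 2`-moment (`fracMoment_half_le`).

Exponent `s` is recovered by Hölder interpolation between `s / 2` and `(1 + s) / 2`
(`fracMoment_le_interpolation`), at the cost of reducing the rate to `μ (1 - s) / 2`. Both steps
need an a priori bound on moments of every order below 1, uniform in the region and in non-real
energies: `exists_fracMoment_le`. It comes from the explicit dependence of the Green function on the
potential at its two endpoints, together with the bounded density.

The number of bonds is polynomial in `L`, so every prefactor loses to the exponential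
(`eventually_mul_rpow_lt_one`). Real energies are reached by Fatou as `η → 0`
(`fracMoment_le_of_forall_im_ne_zero`). -/

noncomputable section

/-! ### Self-adjointness, resolvent bounds and symmetry of the Green function. -/

section Operators

variable {d : ℕ} {Λ : Set (Site d)}

/-- A potential that is bounded on `Λ`. -/
def BddOn (Λ : Set (Site d)) (v : Site d → ℝ) : Prop := ∃ M : ℝ, 0 ≤ M ∧ ∀ x ∈ Λ, |v x| ≤ M

theorem bddOn_of_finite (h : Λ.Finite) (v : Site d → ℝ) : BddOn Λ v :=
  ⟨∑ x ∈ h.toFinset, |v x|, Finset.sum_nonneg fun _ _ => abs_nonneg _, fun _ hx =>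
    Finset.single_le_sum (f := fun x => |v x|) (fun _ _ => abs_nonneg _) (h.mem_toFinset.2 hx)⟩

theorem mulOp_apply {v : Site d → ℝ} (h : BddOn Λ v) (ψ : EllTwo Λ) (x : Λ) :
    mulOp Λ v ψ x = v x * ψ x := by
  have h' : ∃ M : ℝ, 0 ≤ M ∧ ∀ x ∈ Λ, |v x| ≤ M := h
  rw [mulOp, dif_pos h']
  rfl

theorem shiftOp_apply (a : Site d) (ψ : EllTwo Λ) (x : Λ) :
    shiftOp Λ a ψ x = extendZero ψ ((x : Site d) + a) := rfl

theorem schrodingerOp_apply {v : Site d → ℝ} (h : BddOn Λ v) (lam : ℝ) (ψ : EllTwo Λ) (x : Λ) :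
    schrodingerOp Λ lam v ψ x =
      ∑ a ∈ unitSteps d, (ψ x - extendZero ψ ((x : Site d) + a)) + lam * (v x * ψ x) := by
  rw [schrodingerOp, add_apply, sum_apply,
    lp.coeFn_add, Pi.add_apply, lp.coeFn_sum, Finset.sum_apply]
  congr 1
  rw [smul_apply, lp.coeFn_smul, Pi.smul_apply, mulOp_apply h, smul_eq_mul]

theorem extendZero_coe (ψ : Λ → ℂ) (x : Λ) : extendZero ψ (x : Site d) = ψ x := by
  simp [extendZero]

theorem extendZero_of_notMem (ψ : Λ → ℂ) {x : Site d} (h : x ∉ Λ) : extendZero ψ x = 0 := by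
  simp [extendZero, h]

/-- After extension by zero both sums run over the whole lattice, where translation is a bijection.
This is the adjoint relation between opposite shifts. -/
theorem tsum_shift_mul (f g : Λ → ℂ) (a : Site d) :
    ∑' x : Λ, extendZero f ((x : Site d) + a) * g x =
      ∑' x : Λ, f x * extendZero g ((x : Site d) - a) := by
  have h1 : ∑' x : Λ, extendZero f ((x : Site d) + a) * g x =
      ∑' x : Site d, extendZero f (x + a) * extendZero g x := by
    rw [← tsum_subtype_eq_of_support_subset (s := Λ)]
    · simp_rw [extendZero_coe]
    · intro x hx
      by_contra hc
      exact hx (by simp [extendZero_of_notMem g hc])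
  have h2 : ∑' x : Λ, f x * extendZero g ((x : Site d) - a) =
      ∑' x : Site d, extendZero f x * extendZero g (x - a) := by
    rw [← tsum_subtype_eq_of_support_subset (s := Λ)]
    · simp_rw [extendZero_coe]
    · intro x hx
      by_contra hc
      exact hx (by simp [extendZero_of_notMem f hc])
  rw [h1, h2, ← (Equiv.addRight a).tsum_eq (fun x => extendZero f x * extendZero g (x - a))]
  simp

theorem neg_mem_unitSteps {a : Site d} (h : a ∈ unitSteps d) : -a ∈ unitSteps d := by
  simp only [unitSteps, Finset.mem_filter, Finset.mem_Icc] at h ⊢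
  refine ⟨⟨neg_le_neg h.1.2, ?_⟩, by simpa using h.2⟩
  simpa using neg_le_neg h.1.1

theorem star_extendZero (ψ : Λ → ℂ) (x : Site d) :
    star (extendZero ψ x) = extendZero (star ψ) x := by
  by_cases h : x ∈ Λ <;> simp [extendZero, h]

theorem inner_shiftOp (a : Site d) (f g : EllTwo Λ) :
    inner ℂ (shiftOp Λ a f) g = inner ℂ f (shiftOp Λ (-a) g) := by
  rw [lp.inner_eq_tsum, lp.inner_eq_tsum]
  have := tsum_shift_mul (star (f : Λ → ℂ)) g a
  simp only [RCLike.inner_apply, shiftOp_apply]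
  calc _ = ∑' x : Λ, extendZero (star (f : Λ → ℂ)) ((x : Site d) + a) * g x := by
        refine tsum_congr fun x => ?_
        rw [← star_extendZero, mul_comm]; rfl
    _ = _ := by
        rw [this]
        refine tsum_congr fun x => ?_
        rw [mul_comm, sub_eq_add_neg]; rfl

theorem inner_schrodingerOp {v : Site d → ℝ} (h : BddOn Λ v) (lam : ℝ) (f g : EllTwo Λ) :
    inner ℂ (schrodingerOp Λ lam v f) g = inner ℂ f (schrodingerOp Λ lam v g) := by
  have hm : inner ℂ (mulOp Λ v f) g = inner ℂ f (mulOp Λ v g) := by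
    rw [lp.inner_eq_tsum, lp.inner_eq_tsum]
    refine tsum_congr fun x => ?_
    rw [mulOp_apply h, mulOp_apply h]
    simp only [RCLike.inner_apply, map_mul, Complex.conj_ofReal]
    ring
  simp only [schrodingerOp, add_apply, sum_apply,
    smul_apply, inner_add_left, inner_add_right, sum_inner, inner_sum,
    sub_apply, one_apply_eq_self, inner_sub_left, inner_sub_right,
    inner_smul_left, inner_smul_right, Complex.conj_ofReal, hm, inner_shiftOp,
    Finset.sum_sub_distrib]
  congr 2
  -- The set of unit steps is invariant under negation, so the shift adjoints only permute the
  -- hopping terms.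
  exact Finset.sum_nbij' (fun a => -a) (fun a => -a) (fun a => neg_mem_unitSteps)
    (fun a => neg_mem_unitSteps) (by simp) (by simp) (by simp)

theorem isSelfAdjoint_schrodingerOp {v : Site d → ℝ} (h : BddOn Λ v) (lam : ℝ) :
    IsSelfAdjoint (schrodingerOp Λ lam v) := by
  rw [ContinuousLinearMap.isSelfAdjoint_iff_isSymmetric]
  exact fun f g => inner_schrodingerOp h lam f g

/-- The operator `H_Λ - z`. -/
abbrev shifted (Λ : Set (Site d)) (lam : ℝ) (v : Site d → ℝ) (z : ℂ) : EllTwo Λ →L[ℂ] EllTwo Λ :=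
  schrodingerOp Λ lam v - algebraMap ℂ (EllTwo Λ →L[ℂ] EllTwo Λ) z

theorem isUnit_shifted {v : Site d → ℝ} (h : BddOn Λ v) (lam : ℝ) {z : ℂ} (hz : z.im ≠ 0) :
    IsUnit (shifted Λ lam v z) := by
  have : z ∉ spectrum ℂ (schrodingerOp Λ lam v) := fun hc =>
    hz ((isSelfAdjoint_schrodingerOp h lam).im_eq_zero_of_mem_spectrum hc)
  rw [spectrum.notMem_iff] at this
  rw [← IsUnit.neg_iff]
  simpa [shifted] using this

theorem shifted_apply (lam : ℝ) (v : Site d → ℝ) (z : ℂ) (ψ : EllTwo Λ) :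
    shifted Λ lam v z ψ = schrodingerOp Λ lam v ψ - z • ψ := by
  simp [shifted, Algebra.algebraMap_eq_smul_one]

/-- The quadratic form of `H` is real, so the imaginary part of `⟨ψ, (H - z) ψ⟩` is exactly `-(Im z)
‖ψ‖²`; Cauchy-Schwarz does the rest. -/
theorem norm_le_shifted {v : Site d → ℝ} (h : BddOn Λ v) (lam : ℝ) (z : ℂ) (ψ : EllTwo Λ) :
    |z.im| * ‖ψ‖ ≤ ‖shifted Λ lam v z ψ‖ := by
  have h0 : (inner ℂ ψ (schrodingerOp Λ lam v ψ)).im = 0 := by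
    have := inner_schrodingerOp h lam ψ ψ
    rw [← inner_conj_symm] at this
    exact Complex.conj_eq_iff_im.1 this
  have h1 : (inner ℂ ψ (shifted Λ lam v z ψ)).im = -(z.im * ‖ψ‖ ^ 2) := by
    rw [shifted_apply, inner_sub_right, inner_smul_right, Complex.sub_im, h0,
      inner_self_eq_norm_sq_to_K]
    norm_cast
    simp [-Complex.ofReal_pow]
  have h2 : |z.im| * ‖ψ‖ ^ 2 ≤ ‖ψ‖ * ‖shifted Λ lam v z ψ‖ := by
    calc |z.im| * ‖ψ‖ ^ 2 = |(inner ℂ ψ (shifted Λ lam v z ψ)).im| := by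
          rw [h1, abs_neg, abs_mul, abs_of_nonneg (sq_nonneg ‖ψ‖)]
      _ ≤ _ := (Complex.abs_im_le_norm _).trans (norm_inner_le_norm _ _)
  rcases eq_or_lt_of_le (norm_nonneg ψ) with h3 | h3
  · rw [← h3, mul_zero]; exact norm_nonneg _
  · nlinarith

/-- The resolvent `(H_Λ - z)⁻¹`. -/
abbrev resolv (Λ : Set (Site d)) (lam : ℝ) (v : Site d → ℝ) (z : ℂ) : EllTwo Λ →L[ℂ] EllTwo Λ :=
  Ring.inverse (shifted Λ lam v z)

theorem green_coe (lam : ℝ) (v : Site d → ℝ) (z : ℂ) (x y : Λ) :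
    green Λ lam v z x y = resolv Λ lam v z (lp.single 2 y (1 : ℂ)) x := by
  rw [green, dif_pos ⟨x.2, y.2⟩]

theorem shifted_resolv {v : Site d → ℝ} (h : BddOn Λ v) (lam : ℝ) {z : ℂ} (hz : z.im ≠ 0)
    (ψ : EllTwo Λ) : shifted Λ lam v z (resolv Λ lam v z ψ) = ψ := by
  rw [← mul_apply_eq_comp, Ring.mul_inverse_cancel _ (isUnit_shifted h lam hz),
    one_apply_eq_self]

theorem resolv_shifted {v : Site d → ℝ} (h : BddOn Λ v) (lam : ℝ) {z : ℂ} (hz : z.im ≠ 0)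
    (ψ : EllTwo Λ) : resolv Λ lam v z (shifted Λ lam v z ψ) = ψ := by
  rw [← mul_apply_eq_comp, Ring.inverse_mul_cancel _ (isUnit_shifted h lam hz),
    one_apply_eq_self]

theorem norm_resolv_le {v : Site d → ℝ} (h : BddOn Λ v) (lam : ℝ) {z : ℂ} (hz : z.im ≠ 0)
    (ψ : EllTwo Λ) : ‖resolv Λ lam v z ψ‖ ≤ |z.im|⁻¹ * ‖ψ‖ := by
  have := norm_le_shifted h lam z (resolv Λ lam v z ψ)
  rw [shifted_resolv h lam hz] at this
  rwa [inv_mul_eq_div, le_div_iff₀ (abs_pos.2 hz), mul_comm]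

theorem star_schrodingerOp {v : Site d → ℝ} (h : BddOn Λ v) (lam : ℝ) (f : EllTwo Λ) :
    star (schrodingerOp Λ lam v f) = schrodingerOp Λ lam v (star f) := by
  ext x
  rw [lp.star_apply, schrodingerOp_apply h, schrodingerOp_apply h, lp.coeFn_star, star_add,
    star_sum]
  simp only [star_sub, star_extendZero, Pi.star_apply, star_mul']
  simp

/-- Since `H` is real as well as self-adjoint, its resolvent is symmetric without conjugating `z`.
The two-site formula below needs this to use a single off-diagonal entry. -/
theorem green_symm {v : Site d → ℝ} (h : BddOn Λ v) (lam : ℝ) {z : ℂ} (hz : z.im ≠ 0)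
    (x y : Site d) : green Λ lam v z x y = green Λ lam v z y x := by
  by_cases hxy : x ∈ Λ ∧ y ∈ Λ
  swap
  · rw [green, dif_neg hxy, green, dif_neg (fun hc => hxy hc.symm)]
  obtain ⟨hx, hy⟩ := hxy
  lift x to Λ using hx
  lift y to Λ using hy
  rw [green_coe, green_coe]
  set f := resolv Λ lam v z (lp.single 2 x (1 : ℂ)) with hf
  set g := resolv Λ lam v z (lp.single 2 y (1 : ℂ)) with hg
  have hf' : shifted Λ lam v z f = lp.single 2 x (1 : ℂ) := shifted_resolv h lam hz _
  have hg' : shifted Λ lam v z g = lp.single 2 y (1 : ℂ) := shifted_resolv h lam hz _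
  -- With `star` in the first slot the inner product is a bilinear pairing, for which `H - z` is
  -- symmetric even when `z` is not real.
  have key : inner ℂ (star (shifted Λ lam v z f)) g = inner ℂ (star f) (shifted Λ lam v z g) := by
    rw [shifted_apply, shifted_apply, star_sub, star_schrodingerOp h, star_smul, inner_sub_left,
      inner_sub_right, inner_schrodingerOp h, inner_smul_left, inner_smul_right]
    simp
  have hs : star (lp.single 2 x (1 : ℂ) : EllTwo Λ) = lp.single 2 x (1 : ℂ) := by
    ext w
    rw [lp.star_apply]
    by_cases hw : w = x
    · subst hw; simp
    · rw [lp.single_apply_ne _ _ _ hw, star_zero]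
  rw [hf', hg', hs, lp.inner_single_left, lp.inner_single_right, lp.star_apply] at key
  simpa using key

end Operators

/-! ### Resolvent identities and approximation by truncated potentials. -/

section GreenIdentities

open Filter Topology

variable {d : ℕ} {Λ : Set (Site d)}

open Classical in
/-- The vector `c • δ_s` in `ℓ²(Λ)`; it is `0` if `s ∉ Λ`. -/
def siteVec (Λ : Set (Site d)) (s : Site d) (c : ℂ) : EllTwo Λ :=
  if h : s ∈ Λ then lp.single 2 (⟨s, h⟩ : Λ) c else 0

theorem siteVec_apply (s : Site d) (c : ℂ) (x : Λ) :
    siteVec Λ s c x = if (x : Site d) = s then c else 0 := by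
  by_cases hs : s ∈ Λ
  · rw [siteVec, dif_pos hs]
    by_cases hx : (x : Site d) = s
    · subst hx
      simp
    · rw [if_neg hx, lp.single_apply_ne]
      exact fun hc => hx (by rw [hc])
  · have hx : (x : Site d) ≠ s := fun hc => hs (hc ▸ x.2)
    rw [siteVec, dif_neg hs, if_neg hx]
    rfl

theorem siteVec_smul (s : Site d) (c : ℂ) : siteVec Λ s c = c • siteVec Λ s 1 := by
  ext x
  rw [lp.coeFn_smul, Pi.smul_apply, siteVec_apply, siteVec_apply]
  simp

theorem green_eq_extendZero (lam : ℝ) (v : Site d → ℝ) (z : ℂ) (x y : Site d) :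
    green Λ lam v z x y = extendZero (resolv Λ lam v z (siteVec Λ y 1)) x := by
  by_cases hy : y ∈ Λ
  · by_cases hx : x ∈ Λ
    · simp [green, extendZero, siteVec, hx, hy]
    · simp [green, extendZero, hx]
  · by_cases hx : x ∈ Λ <;> simp [green, extendZero, siteVec, hx, hy]

theorem extendZero_sub (f g : EllTwo Λ) (x : Site d) :
    extendZero (f - g : EllTwo Λ) x = extendZero f x - extendZero g x := by
  by_cases h : x ∈ Λ <;> simp [extendZero, h]

theorem extendZero_smul (c : ℂ) (f : EllTwo Λ) (x : Site d) :
    extendZero (c • f : EllTwo Λ) x = c * extendZero f x := by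
  by_cases h : x ∈ Λ <;> simp [extendZero, h]

theorem extendZero_sum {ι : Type*} (t : Finset ι) (f : ι → EllTwo Λ) (x : Site d) :
    extendZero (∑ i ∈ t, f i : EllTwo Λ) x = ∑ i ∈ t, extendZero (f i) x := by
  by_cases h : x ∈ Λ
  · simp only [extendZero, dif_pos h]
    rw [lp.coeFn_sum, Finset.sum_apply]
  · simp [extendZero, h]

theorem norm_extendZero_le (f : EllTwo Λ) (x : Site d) : ‖extendZero f x‖ ≤ ‖f‖ := by
  by_cases h : x ∈ Λ
  · rw [extendZero, dif_pos h]
    exact lp.norm_apply_le_norm two_ne_zero f _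
  · simp [extendZero, h]

theorem BddOn.sub {v w : Site d → ℝ} (hv : BddOn Λ v) (hw : BddOn Λ w) : BddOn Λ (v - w) := by
  obtain ⟨M, hM, h⟩ := hv
  obtain ⟨N, hN, h'⟩ := hw
  exact ⟨M + N, add_nonneg hM hN, fun x hx => (abs_sub _ _).trans (add_le_add (h x hx) (h' x hx))⟩

theorem BddOn.indicator {v : Site d → ℝ} (hv : BddOn Λ v) (s : Set (Site d)) :
    BddOn Λ (s.indicator v) := by
  obtain ⟨M, hM, h⟩ := hv
  refine ⟨M, hM, fun x hx => ?_⟩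
  by_cases hs : x ∈ s
  · rw [Set.indicator_of_mem hs]; exact h x hx
  · rw [Set.indicator_of_notMem hs, abs_zero]; exact hM

theorem bddOn_finset_indicator (Λ : Set (Site d)) (F : Finset (Site d)) (v : Site d → ℝ) :
    BddOn Λ ((F : Set (Site d)).indicator v) := by
  obtain ⟨M, hM, h⟩ := bddOn_of_finite F.finite_toSet v
  refine ⟨M, hM, fun x _ => ?_⟩
  by_cases hs : x ∈ (F : Set (Site d))
  · rw [Set.indicator_of_mem hs]; exact h x hs
  · rw [Set.indicator_of_notMem hs, abs_zero]; exact hM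

theorem schrodingerOp_congr {v w : Site d → ℝ} (hv : BddOn Λ v) (h : ∀ x ∈ Λ, v x = w x)
    (lam : ℝ) : schrodingerOp Λ lam v = schrodingerOp Λ lam w := by
  have hw : BddOn Λ w := by
    obtain ⟨M, hM, h'⟩ := hv
    exact ⟨M, hM, fun x hx => h x hx ▸ h' x hx⟩
  ext ψ x
  rw [schrodingerOp_apply hv, schrodingerOp_apply hw, h x x.2]

theorem green_congr {v w : Site d → ℝ} (hv : BddOn Λ v) (h : ∀ x ∈ Λ, v x = w x)
    (lam : ℝ) (z : ℂ) (x y : Site d) : green Λ lam v z x y = green Λ lam w z x y := by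
  rw [green_eq_extendZero, green_eq_extendZero, resolv, resolv, shifted, shifted,
    schrodingerOp_congr hv h]

theorem mulOp_indicator (F : Finset (Site d)) (v : Site d → ℝ) (φ : EllTwo Λ) :
    mulOp Λ ((F : Set (Site d)).indicator v) φ =
      ∑ s ∈ F, siteVec Λ s (v s * extendZero φ s) := by
  ext x
  rw [mulOp_apply (bddOn_finset_indicator Λ F v), lp.coeFn_sum, Finset.sum_apply]
  simp only [siteVec_apply, Finset.sum_ite_eq, extendZero_coe]
  by_cases hx : (x : Site d) ∈ F <;> simp [hx]

/-- Second resolvent identity for two potentials over the same hopping term. -/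
theorem resolv_eq_sub {v w : Site d → ℝ} (hv : BddOn Λ v) (hw : BddOn Λ w) (lam : ℝ) {z : ℂ}
    (hz : z.im ≠ 0) (ψ : EllTwo Λ) :
    resolv Λ lam v z ψ = resolv Λ lam w z ψ -
      (lam : ℂ) • resolv Λ lam w z (mulOp Λ (v - w) (resolv Λ lam v z ψ)) := by
  set φ := resolv Λ lam v z ψ with hφ
  have h1 : shifted Λ lam w z φ = ψ - (lam : ℂ) • mulOp Λ (v - w) φ := by
    conv_rhs => rw [← shifted_resolv hv lam hz ψ, ← hφ]
    ext x
    rw [shifted_apply, shifted_apply]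
    simp only [lp.coeFn_sub, Pi.sub_apply, lp.coeFn_smul, Pi.smul_apply, schrodingerOp_apply hv,
      schrodingerOp_apply hw, mulOp_apply (hv.sub hw), smul_eq_mul]
    push_cast
    ring
  conv_lhs => rw [← resolv_shifted hw lam hz φ, h1, map_sub, map_smul]

/-- Expansion of the Green function in the values of the potential at finitely many sites. -/
theorem green_eq_sub_sum {v : Site d → ℝ} (hv : BddOn Λ v) (lam : ℝ) {z : ℂ} (hz : z.im ≠ 0)
    (S : Finset (Site d)) (a b : Site d) :
    green Λ lam v z a b = green Λ lam ((S : Set (Site d))ᶜ.indicator v) z a b -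
      ∑ s ∈ S, lam * v s * green Λ lam ((S : Set (Site d))ᶜ.indicator v) z a s *
        green Λ lam v z s b := by
  set w := (S : Set (Site d))ᶜ.indicator v with hw
  have hvw : v - w = (S : Set (Site d)).indicator v := by
    rw [hw, sub_eq_iff_eq_add, Set.indicator_self_add_compl]
  rw [green_eq_extendZero lam v, resolv_eq_sub hv (hv.indicator _) lam hz, ← hw, hvw,
    mulOp_indicator, extendZero_sub, extendZero_smul, map_sum, extendZero_sum, Finset.mul_sum,
    green_eq_extendZero lam w]
  congr 1
  refine Finset.sum_congr rfl fun s _ => ?_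
  rw [siteVec_smul, map_smul, extendZero_smul, ← green_eq_extendZero, ← green_eq_extendZero]
  ring

theorem continuous_eval_site (x : Λ) : Continuous fun φ : EllTwo Λ => φ x := by
  refine (LipschitzWith.of_dist_le_mul (K := 1) fun f g => ?_).continuous
  rw [dist_eq_norm, dist_eq_norm, NNReal.coe_one, one_mul]
  exact lp.norm_apply_le_norm two_ne_zero (f - g) _

/-- A truncated potential enters the operator through finitely many coordinates, affinely, and
inversion is norm continuous at units. This is the source of all measurability below. -/
theorem continuous_green_indicator (Λ : Set (Site d)) (F : Finset (Site d)) (lam : ℝ) {z : ℂ}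
    (hz : z.im ≠ 0) (x y : Site d) :
    Continuous fun v : Site d → ℝ => green Λ lam ((F : Set (Site d)).indicator v) z x y := by
  by_cases hxy : x ∈ Λ ∧ y ∈ Λ
  swap
  · simp only [green, dif_neg hxy]
    exact continuous_const
  have hop : ∀ v : Site d → ℝ, schrodingerOp Λ lam ((F : Set (Site d)).indicator v) =
      ∑ a ∈ unitSteps d, (1 - shiftOp Λ a) + (lam : ℂ) •
        ∑ s ∈ F, (v s : ℂ) • mulOp Λ ((({s} : Finset (Site d)) : Set (Site d)).indicator 1) := by
    intro v
    rw [schrodingerOp]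
    congr 2
    ext φ : 1
    rw [mulOp_indicator, sum_apply]
    refine Finset.sum_congr rfl fun s _ => ?_
    rw [smul_apply, mulOp_indicator, Finset.sum_singleton, siteVec_smul,
      siteVec_smul (c := _ * _), smul_smul]
    simp
  simp only [green, dif_pos hxy]
  have hc : Continuous fun v : Site d → ℝ =>
      resolv Λ lam ((F : Set (Site d)).indicator v) z := by
    rw [continuous_iff_continuousAt]
    intro v
    obtain ⟨u, hu⟩ := isUnit_shifted (bddOn_finset_indicator Λ F v) lam hz
    have h1 := NormedRing.inverse_continuousAt u
    rw [hu] at h1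
    refine ContinuousAt.comp (f := fun v : Site d → ℝ =>
      shifted Λ lam ((F : Set (Site d)).indicator v) z) h1 (Continuous.continuousAt ?_)
    simp only [shifted, hop]
    fun_prop
  exact (continuous_eval_site _).comp (hc.clm_apply continuous_const)

theorem hasSum_siteVec (φ : EllTwo Λ) : HasSum (fun s => siteVec Λ s (extendZero φ s)) φ := by
  rw [← hasSum_subtype_iff_of_support_subset (s := Λ)]
  · convert lp.hasSum_single (p := 2) (by norm_num) φ using 1
    ext1 x
    simp [siteVec, extendZero]
  · intro s hs
    by_contra hc
    exact hs (by simp [siteVec, hc])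

/-- The Green function is the limit of those with potentials truncated to finite sets. -/
theorem tendsto_green_indicator {v : Site d → ℝ} (hv : BddOn Λ v) (lam : ℝ) {z : ℂ}
    (hz : z.im ≠ 0) (x y : Site d) :
    Tendsto (fun F : Finset (Site d) => green Λ lam ((F : Set (Site d)).indicator v) z x y) atTop
      (𝓝 (green Λ lam v z x y)) := by
  set φ := resolv Λ lam v z (siteVec Λ y 1) with hφ
  have h1 : Tendsto (fun F : Finset (Site d) =>
      mulOp Λ (v - (F : Set (Site d)).indicator v) φ) atTop (𝓝 0) := by
    -- Truncation need not converge in operator norm, but on the fixed vector `φ` the error is the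
    -- tail of the convergent site expansion of `mulOp Λ v φ`.
    have h2 : ∀ F : Finset (Site d), mulOp Λ (v - (F : Set (Site d)).indicator v) φ =
        mulOp Λ v φ - ∑ s ∈ F, siteVec Λ s (extendZero (mulOp Λ v φ) s) := by
      intro F
      have h3 : mulOp Λ (v - (F : Set (Site d)).indicator v) φ =
          mulOp Λ v φ - mulOp Λ ((F : Set (Site d)).indicator v) φ := by
        ext w
        rw [lp.coeFn_sub, Pi.sub_apply, mulOp_apply hv, mulOp_apply (bddOn_finset_indicator Λ F v),
          mulOp_apply (hv.sub (bddOn_finset_indicator Λ F v)), Pi.sub_apply]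
        push_cast
        ring
      rw [h3, mulOp_indicator]
      congr 1
      refine Finset.sum_congr rfl fun s _ => ?_
      by_cases hs : s ∈ Λ
      · congr 1
        rw [extendZero, dif_pos hs, extendZero, dif_pos hs, mulOp_apply hv]
      · simp [siteVec, hs]
    simp only [h2]
    simpa using (tendsto_const_nhds (x := mulOp Λ v φ)).sub (hasSum_siteVec (mulOp Λ v φ))
  rw [tendsto_iff_norm_sub_tendsto_zero]
  refine squeeze_zero (g := fun F : Finset (Site d) => |lam| * (|z.im|⁻¹ *
    ‖mulOp Λ (v - (F : Set (Site d)).indicator v) φ‖)) (fun _ => norm_nonneg _) (fun F => ?_) ?_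
  · have hF := bddOn_finset_indicator Λ F v
    rw [norm_sub_rev, green_eq_extendZero, green_eq_extendZero, ← extendZero_sub,
      resolv_eq_sub hv hF lam hz, sub_sub_cancel_left]
    refine (norm_extendZero_le _ _).trans ?_
    rw [norm_neg, norm_smul, Complex.norm_real, Real.norm_eq_abs]
    exact mul_le_mul_of_nonneg_left (norm_resolv_le hF lam hz _) (abs_nonneg _)
  · have := (h1.norm.const_mul |z.im|⁻¹).const_mul |lam|
    simpa using this

theorem mem_boundaryBonds {Λ : Finset (Site d)} {b : Site d × Site d} :
    b ∈ boundaryBonds Λ ↔ b.1 ∈ Λ ∧ b.2 - b.1 ∈ unitSteps d ∧ b.2 ∉ Λ := by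
  simp only [boundaryBonds, Finset.mem_filter, Finset.mem_image, Finset.mem_product, Prod.exists]
  constructor
  · rintro ⟨⟨u, a, ⟨hu, ha⟩, rfl⟩, hb⟩
    exact ⟨hu, by simpa using ha, hb⟩
  · rintro ⟨h1, h2, h3⟩
    exact ⟨⟨b.1, b.2 - b.1, ⟨h1, h2⟩, by simp⟩, h3⟩

theorem sum_boundaryBonds_eq (Λ : Finset (Site d)) (g : Site d → ℂ) (hg : ∀ w ∉ Λ, g w = 0)
    {x : Site d} (hx : x ∉ Λ) :
    ∑ b ∈ boundaryBonds Λ, (if x = b.2 then g b.1 else 0) = ∑ a ∈ unitSteps d, g (x + a) := by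
  rw [← Finset.sum_filter]
  have h1 : ∑ a ∈ unitSteps d, g (x + a) = ∑ a ∈ unitSteps d with x + a ∈ Λ, g (x + a) := by
    rw [Finset.sum_filter]
    refine Finset.sum_congr rfl fun a _ => ?_
    split_ifs with h
    · rfl
    · exact hg _ h
  rw [h1]
  refine Finset.sum_nbij' (fun b => b.1 - b.2) (fun a => (x + a, x)) ?_ ?_ ?_ ?_ ?_
  · intro b hb
    rw [Finset.mem_filter, mem_boundaryBonds] at hb
    rw [Finset.mem_filter, hb.2]
    exact ⟨by simpa using neg_mem_unitSteps hb.1.2.1, by simpa using hb.1.1⟩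
  · intro a ha
    rw [Finset.mem_filter] at ha
    rw [Finset.mem_filter, mem_boundaryBonds]
    exact ⟨⟨ha.2, by simpa using neg_mem_unitSteps ha.1, hx⟩, rfl⟩
  · intro b hb
    rw [Finset.mem_filter] at hb
    ext1
    · simp [hb.2]
    · exact hb.2
  · intro a _
    simp
  · intro b hb
    rw [Finset.mem_filter] at hb
    simp [hb.2]

/-- The geometric resolvent identity relating a finite region to the whole lattice. -/
theorem green_finset_eq (Λ : Finset (Site d)) {v : Site d → ℝ} (hv : BddOn Set.univ v) (lam : ℝ)
    {z : ℂ} (hz : z.im ≠ 0) (x u : Site d) (hu : u ∈ Λ) :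
    green (Λ : Set (Site d)) lam v z x u = green Set.univ lam v z x u -
      ∑ b ∈ boundaryBonds Λ,
        green Set.univ lam v z x b.2 * green (Λ : Set (Site d)) lam v z b.1 u := by
  have hvΛ : BddOn (Λ : Set (Site d)) v := bddOn_of_finite Λ.finite_toSet v
  set g := resolv (Λ : Set (Site d)) lam v z (siteVec _ u 1) with hg
  have hgeq : shifted (Λ : Set (Site d)) lam v z g = siteVec _ u 1 := shifted_resolv hvΛ lam hz _
  -- `G` is the finite-volume solution `g` extended by zero to the whole lattice.
  obtain ⟨G, hG⟩ : ∃ G : EllTwo (Set.univ : Set (Site d)), ∀ w, G w = extendZero g (w : Site d) := by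
    refine ⟨∑ w ∈ Λ, siteVec Set.univ w (extendZero g w), fun w => ?_⟩
    rw [lp.coeFn_sum, Finset.sum_apply]
    simp only [siteVec_apply, Finset.sum_ite_eq]
    split_ifs with h
    · rfl
    · rw [extendZero_of_notMem _ (by simpa using h)]
  have hG' : ∀ w : Site d, extendZero G w = extendZero g w := fun w => by
    rw [← hG ⟨w, trivial⟩, extendZero, dif_pos (Set.mem_univ w)]
  -- Inside `Λ` the extension solves the same equation as `g`; outside, only hopping across a
  -- boundary bond survives, with a minus sign.
  have key : shifted Set.univ lam v z G =
      siteVec _ u 1 - ∑ b ∈ boundaryBonds Λ, siteVec _ b.2 (extendZero g b.1) := by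
    ext w
    have hs : (∑ b ∈ boundaryBonds Λ, siteVec Set.univ b.2 (extendZero g b.1) :
        EllTwo (Set.univ : Set (Site d))) w =
        ∑ b ∈ boundaryBonds Λ, if (w : Site d) = b.2 then extendZero g b.1 else 0 := by
      rw [lp.coeFn_sum, Finset.sum_apply]
      simp only [siteVec_apply]
    rw [shifted_apply, lp.coeFn_sub, lp.coeFn_sub, Pi.sub_apply, Pi.sub_apply,
      schrodingerOp_apply hv, lp.coeFn_smul, Pi.smul_apply, hs]
    simp only [hG, hG', siteVec_apply]
    by_cases hw : (w : Site d) ∈ Λ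
    · have h0 : ∑ b ∈ boundaryBonds Λ,
          (if (w : Site d) = b.2 then extendZero g b.1 else 0) = 0 := by
        refine Finset.sum_eq_zero fun b hb => ?_
        rw [if_neg]
        rintro h
        exact (mem_boundaryBonds.1 hb).2.2 (h ▸ hw)
      have h1 := congrArg (fun f : EllTwo (Λ : Set (Site d)) => f ⟨w, hw⟩) hgeq
      simp only [shifted_apply, lp.coeFn_sub, Pi.sub_apply, schrodingerOp_apply hvΛ,
        lp.coeFn_smul, Pi.smul_apply, siteVec_apply] at h1
      rw [h0, sub_zero, ← h1, ← extendZero_coe (g : _ → ℂ) ⟨w, hw⟩]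
    · have hwu : (w : Site d) ≠ u := fun h => hw (h ▸ hu)
      rw [sum_boundaryBonds_eq Λ (extendZero g)
        (fun w hw => extendZero_of_notMem _ (by simpa using hw)) hw,
        extendZero_of_notMem _ (by simpa using hw), if_neg hwu]
      simp
  have h2 := congrArg (fun f => extendZero (resolv Set.univ lam v z f) x) key
  simp only [resolv_shifted hv lam hz, hG', map_sub, map_sum, extendZero_sub, extendZero_sum] at h2
  rw [green_eq_extendZero, ← hg, h2, green_eq_extendZero]
  congr 1
  refine Finset.sum_congr rfl fun b _ => ?_
  rw [siteVec_smul, map_smul, extendZero_smul,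
    green_eq_extendZero (Λ := Set.univ), green_eq_extendZero (Λ := (Λ : Set (Site d))), mul_comm]

end GreenIdentities

/-! ### Measurability of Green functions and almost sure boundedness of the potential. -/

section Measurability

open Filter Topology

variable {d : ℕ}

theorem measurable_green_finset {α : Type*} [MeasurableSpace α] (Λ : Finset (Site d))
    {W : Site d → α → ℝ} (hW : ∀ x, Measurable (W x)) (lam : ℝ) {z : ℂ} (hz : z.im ≠ 0)
    (x y : Site d) :
    Measurable fun a => green (Λ : Set (Site d)) lam (fun w => W w a) z x y := by
  have h1 : ∀ a, green (Λ : Set (Site d)) lam (fun w => W w a) z x y =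
      green (Λ : Set (Site d)) lam ((Λ : Set (Site d)).indicator fun w => W w a) z x y := fun a =>
    green_congr (bddOn_of_finite Λ.finite_toSet _)
      (fun w hw => by rw [Set.indicator_of_mem hw]) lam z x y
  simp only [h1]
  exact (continuous_green_indicator (Λ : Set (Site d)) Λ lam hz x y).measurable.comp
    (measurable_pi_lambda _ hW)

theorem aemeasurable_green {Ω : Type*} [MeasurableSpace Ω] {P : Measure Ω} (Λ : Set (Site d))
    {V : Site d → Ω → ℝ} (hV : ∀ x, Measurable (V x))
    (hb : ∀ᵐ ω ∂P, BddOn Λ fun w => V w ω) (lam : ℝ) {z : ℂ} (hz : z.im ≠ 0) (x y : Site d) :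
    AEMeasurable (fun ω => green Λ lam (fun w => V w ω) z x y) P := by
  refine aemeasurable_of_tendsto_metrizable_ae (atTop : Filter (Finset (Site d)))
    (f := fun (F : Finset (Site d)) ω => green Λ lam ((F : Set (Site d)).indicator fun w => V w ω) z x y)
    (fun F => ?_) ?_
  · exact ((continuous_green_indicator Λ F lam hz x y).measurable.comp
      (measurable_pi_lambda _ hV)).aemeasurable
  · filter_upwards [hb] with ω hω
    exact tendsto_green_indicator hω lam hz x y

theorem IsRegularPotential.ae_bddOn {Ω : Type*} [MeasurableSpace Ω] {P : Measure Ω}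
    {V : Site d → Ω → ℝ} (hV : IsRegularPotential P V) (Λ : Set (Site d)) :
    ∀ᵐ ω ∂P, BddOn Λ fun w => V w ω := by
  obtain ⟨ρ, hρ, -, hsupp, hmap⟩ := hV.density
  obtain ⟨R, hR⟩ := hsupp.isCompact.isBounded.subset_closedBall 0
  have h1 : ∀ x, ∀ᵐ ω ∂P, |V x ω| ≤ R := by
    intro x
    have h2 : ∀ᵐ t ∂(P.map (V x)), |t| ≤ R := by
      rw [hmap x, ae_withDensity_iff hρ.coe_nnreal_ennreal]
      refine Eventually.of_forall fun t ht => ?_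
      have : t ∈ tsupport ρ := subset_tsupport _ (by simpa using ht)
      simpa using hR this
    exact ae_of_ae_map (hV.measurable x).aemeasurable h2
  filter_upwards [ae_all_iff.2 h1] with ω hω
  exact ⟨|R|, abs_nonneg _, fun x _ => (hω x).trans (le_abs_self _)⟩

end Measurability

/-! ### Averaging over the potential at one site. -/

section SingleSite

/-- The singularity `|v|^(-t)` is integrable for `t < 1`. Discarding the imaginary part of `c` only
increases the integrand, and translation invariance of Lebesgue measure removes the real part, so
the bound does not see `c`. -/
theorem exists_lintegral_inv_rpow_le (ν : Measure ℝ) [IsProbabilityMeasure ν] {M : ℝ≥0}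
    (hν : ν ≤ M • (volume : Measure ℝ)) {lam : ℝ} (hlam : 0 < lam) {t : ℝ} (ht0 : 0 < t)
    (ht1 : t < 1) :
    ∃ K : ℝ≥0∞, K ≠ ∞ ∧ ∀ c : ℂ, ∫⁻ v, ‖(lam : ℂ) * (v : ℝ) + c‖ₑ⁻¹ ^ t ∂ν ≤ K := by
  let R : ℝ := lam⁻¹
  have hR : 0 < R := inv_pos.2 hlam
  -- `F` carries the singular part only: beyond `R = 1 / lam` the integrand is at most 1.
  let F : ℝ → ℝ≥0∞ := (Set.Ioc 0 R).indicator fun v => ENNReal.ofReal (lam ^ (-t) * v ^ (-t))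
  have hF : ∫⁻ v, F v < ∞ := by
    rw [lintegral_indicator measurableSet_Ioc]
    have h := intervalIntegral.intervalIntegrable_rpow' (a := 0) (b := R) (r := -t) (by linarith)
    rw [intervalIntegrable_iff_integrableOn_Ioc_of_le hR.le] at h
    exact (h.const_mul (lam ^ (-t))).lintegral_lt_top
  have hFm : Measurable F := Measurable.indicator (by fun_prop) measurableSet_Ioc
  have hpos : ∀ v : ℝ, 0 < v → ‖lam * v‖ₑ⁻¹ ^ t ≤ 1 + F v := by
    intro v hv
    have hlv : 0 < lam * v := mul_pos hlam hv
    by_cases hvR : v ≤ R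
    · have h1 : F v = ENNReal.ofReal (lam ^ (-t) * v ^ (-t)) :=
        Set.indicator_of_mem (Set.mem_Ioc.2 ⟨hv, hvR⟩) _
      rw [h1, ← Real.mul_rpow hlam.le hv.le, Real.enorm_of_nonneg hlv.le,
        ← ENNReal.ofReal_inv_of_pos hlv, ENNReal.ofReal_rpow_of_pos (inv_pos.2 hlv),
        Real.inv_rpow hlv.le, Real.rpow_neg hlv.le]
      exact le_add_self
    · refine le_trans ?_ le_self_add
      refine ENNReal.rpow_le_one ?_ ht0.le
      rw [ENNReal.inv_le_one, Real.enorm_of_nonneg hlv.le, ENNReal.one_le_ofReal]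
      have := mul_le_mul_of_nonneg_left (not_le.1 hvR).le hlam.le
      rwa [mul_inv_cancel₀ hlam.ne'] at this
  have hall : ∀ v : ℝ, v ≠ 0 → ‖lam * v‖ₑ⁻¹ ^ t ≤ 1 + (F v + F (-v)) := by
    intro v hv
    rcases lt_or_gt_of_ne hv with h | h
    · have := hpos (-v) (neg_pos.2 h)
      rw [mul_neg, enorm_neg] at this
      exact this.trans (by gcongr; exact le_add_self)
    · exact (hpos v h).trans (by gcongr; exact le_self_add)
  have hneg : ∫⁻ v, F (-v) = ∫⁻ v, F v :=
    (Measure.measurePreserving_neg (volume : Measure ℝ)).lintegral_comp hFm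
  have hac : ν ≪ (volume : Measure ℝ) := (Measure.absolutelyContinuous_of_le hν).trans
    (Measure.smul_absolutelyContinuous (c := M) (μ := (volume : Measure ℝ)))
  refine ⟨1 + M * (2 * ∫⁻ v, F v), by finiteness, fun c => ?_⟩
  let b : ℝ := c.re / lam
  -- At this one point the integrand may be infinite while `F` vanishes; the density makes it
  -- negligible.
  have hne : ∀ᵐ v ∂ν, v + b ≠ 0 := by
    suffices h : ∀ᵐ v : ℝ, v + b ≠ 0 from hac.ae_le h
    rw [ae_iff]
    refine measure_mono_null (t := {-b}) (fun v hv => ?_) (measure_singleton _)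
    have : v + b = 0 := by simpa using hv
    simpa using eq_neg_of_add_eq_zero_left this
  calc ∫⁻ v, ‖(lam : ℂ) * (v : ℝ) + c‖ₑ⁻¹ ^ t ∂ν
      ≤ ∫⁻ v, (1 + (F (v + b) + F (-(v + b)))) ∂ν := by
        refine lintegral_mono_ae ?_
        filter_upwards [hne] with v hv
        refine le_trans ?_ (hall _ hv)
        refine ENNReal.rpow_le_rpow ?_ ht0.le
        rw [ENNReal.inv_le_inv]
        have h1 : lam * (v + b) = ((lam : ℂ) * (v : ℝ) + c).re := by
          simp only [b]
          rw [mul_add, mul_div_cancel₀ _ hlam.ne']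
          simp
        rw [h1, enorm_le_iff_norm_le, Real.norm_eq_abs]
        exact Complex.abs_re_le_norm _
    _ = 1 + ∫⁻ v, (F (v + b) + F (-(v + b))) ∂ν := by
        rw [lintegral_add_left measurable_const]
        simp
    _ ≤ 1 + ∫⁻ v, (F (v + b) + F (-(v + b))) ∂(M • (volume : Measure ℝ)) := by
        gcongr
    _ = 1 + M * (2 * ∫⁻ v, F v) := by
        rw [lintegral_smul_measure, lintegral_add_right_eq_self (fun v => F v + F (-v)) b,
          lintegral_add_left hFm, hneg, two_mul]
        rfl

theorem lintegral_inv_rpow_le_of_indepFun {Ω β : Type*} [MeasurableSpace Ω] [MeasurableSpace β]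
    {P : Measure Ω} [IsProbabilityMeasure P] {X : Ω → ℝ} {Y : Ω → β} (hX : Measurable X)
    (hY : Measurable Y) (hXY : IndepFun X Y P) {lam t : ℝ} {K : ℝ≥0∞}
    (hK : ∀ c : ℂ, ∫⁻ v, ‖(lam : ℂ) * (v : ℝ) + c‖ₑ⁻¹ ^ t ∂(P.map X) ≤ K) {F : β → ℂ}
    (hF : Measurable F) :
    ∫⁻ ω, ‖(lam : ℂ) * (X ω : ℝ) + F (Y ω)‖ₑ⁻¹ ^ t ∂P ≤ K := by
  have hg : Measurable fun q : ℝ × β => ‖(lam : ℂ) * (q.1 : ℝ) + F q.2‖ₑ⁻¹ ^ t := by fun_prop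
  have : IsProbabilityMeasure (P.map X) := Measure.isProbabilityMeasure_map hX.aemeasurable
  have : IsProbabilityMeasure (P.map Y) := Measure.isProbabilityMeasure_map hY.aemeasurable
  calc _ = ∫⁻ q, ‖(lam : ℂ) * (q.1 : ℝ) + F q.2‖ₑ⁻¹ ^ t ∂(P.map fun ω => (X ω, Y ω)) :=
        (lintegral_map hg (hX.prodMk hY)).symm
    _ = ∫⁻ y, ∫⁻ v, ‖(lam : ℂ) * (v : ℝ) + F y‖ₑ⁻¹ ^ t ∂(P.map X) ∂(P.map Y) := by
        rw [(indepFun_iff_map_prod_eq_prod_map_map hX.aemeasurable hY.aemeasurable).1 hXY,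
          lintegral_prod_symm _ hg.aemeasurable]
    _ ≤ ∫⁻ _, K ∂(P.map Y) := lintegral_mono fun y => hK (F y)
    _ = K := by simp

/-- The offset `c` depends only on the potential on a finite set avoiding `x`, hence is independent
of `V x`, and Fubini reduces to the one-variable integral. -/
theorem IsRegularPotential.exists_lintegral_le {d : ℕ} {Ω : Type*} [MeasurableSpace Ω]
    {P : Measure Ω} [IsProbabilityMeasure P] {V : Site d → Ω → ℝ} (hV : IsRegularPotential P V)
    {lam : ℝ} (hlam : 0 < lam) {t : ℝ} (ht0 : 0 < t) (ht1 : t < 1) :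
    ∃ K : ℝ≥0∞, K ≠ ∞ ∧ ∀ (x : Site d) (T : Finset (Site d)), x ∉ T →
      ∀ c : (Site d → ℝ) → ℂ, Measurable c →
        (∀ v, c ((T : Set (Site d)).indicator v) = c v) →
        ∫⁻ ω, ‖(lam : ℂ) * (V x ω : ℝ) + c (fun w => V w ω)‖ₑ⁻¹ ^ t ∂P ≤ K := by
  obtain ⟨ρ, hρ, ⟨M, hM⟩, -, hmap⟩ := hV.density
  have hp : IsProbabilityMeasure (volume.withDensity fun t => (ρ t : ℝ≥0∞)) := by
    rw [← hmap 0]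
    exact Measure.isProbabilityMeasure_map (hV.measurable 0).aemeasurable
  have hle : volume.withDensity (fun t => (ρ t : ℝ≥0∞)) ≤ M • (volume : Measure ℝ) := by
    refine (withDensity_mono (g := fun _ => (M : ℝ≥0∞)) ?_).trans_eq (withDensity_const _)
    exact Filter.Eventually.of_forall fun t => ENNReal.coe_le_coe.2 (hM t)
  obtain ⟨K, hK, hb⟩ := exists_lintegral_inv_rpow_le _ hle hlam ht0 ht1
  refine ⟨K, hK, fun x T hxT c hc hcT => ?_⟩
  classical
  let Y : Ω → (T → ℝ) := fun ω w => V w ω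
  let ext : (T → ℝ) → (Site d → ℝ) := fun u w => if h : w ∈ T then u ⟨w, h⟩ else 0
  have hext : Measurable ext := by
    refine measurable_pi_lambda _ fun w => ?_
    by_cases h : w ∈ T
    · simp only [ext, dif_pos h]
      fun_prop
    · simp only [ext, dif_neg h]
      fun_prop
  have hind : IndepFun (V x) Y P := by
    have h := hV.indep.indepFun_finset {x} T (by simpa using hxT) hV.measurable
    exact h.comp (φ := fun u : (({x} : Finset (Site d)) → ℝ) => u ⟨x, by simp⟩) (ψ := id)
      (by fun_prop) measurable_id
  have h1 := lintegral_inv_rpow_le_of_indepFun (hV.measurable x)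
    (Y := Y) (measurable_pi_lambda _ fun w => hV.measurable w) hind (lam := lam) (t := t) (K := K)
    (by rw [hmap x]; exact hb) (F := c ∘ ext) (hc.comp hext)
  have h2 : ∀ ω, c (fun w => V w ω) = (c ∘ ext) (Y ω) := by
    intro ω
    rw [← hcT, Function.comp_apply]
    congr 1
    ext w
    by_cases h : w ∈ T <;> simp [ext, Y, h]
  simp only [h2]
  exact h1

end SingleSite

/-! ### A priori bound on finite-volume fractional moments. -/

section APriori

/-- Here `p`, `q` are the coupled potentials at the two endpoints and `A`, `D`, `k` the Green
function entries with both removed. Cramer's rule gives `g * (1 + p A + q D + p q Δ) = k`, with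
determinant affine in `p` and in `q`. Each alternative bounds `g` by the inverse of one potential
plus an offset free of that potential, as single-site averaging requires. -/
theorem norm_mul_le_of_two_site {A D k p q g h gx gyx : ℂ} (h1 : g = k - (p * A * g + q * k * h))
    (h2 : h = D - (p * k * g + q * D * h)) (h3 : gx = A - (p * A * gx + q * k * gyx)) :
    ‖g‖ * ‖p + (1 + q * D) / (A + q * (A * D - k * k))‖ ≤ 2 ∨
      ‖g‖ * ‖q + (1 + p * A) / (D + p * (A * D - k * k))‖ ≤ 2 ∨
      ‖g‖ * ‖q + A / (A * D - k * k)‖ ≤ 2 := by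
  set Δ := A * D - k * k with hΔ
  by_cases hk : k = 0
  · have hg : g = 0 := by
      subst hk
      -- `h3` serves only to exclude this degenerate case: with `k = 0` it would force `A = 0`.
      by_cases hpA : 1 + p * A = 0
      · have hA : A = 0 := by linear_combination gx * hpA - h3
        simp [hA] at hpA
      · have : (1 + p * A) * g = 0 := by linear_combination h1
        exact (mul_eq_zero.1 this).resolve_left hpA
    left
    simp [hg]
  have hk0 : 0 < ‖k‖ := norm_pos_iff.2 hk
  have hdet : g * ((1 + p * A) * (1 + q * D) - p * q * (k * k)) = k := by
    linear_combination (1 + q * D) * h1 - q * k * h2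
  by_cases c1 : ‖k‖ ≤ 2 * ‖A + q * Δ‖
  · left
    have hpos : 0 < ‖A + q * Δ‖ := by linarith
    have hne : A + q * Δ ≠ 0 := norm_pos_iff.1 hpos
    have : g * (p + (1 + q * D) / (A + q * Δ)) = k / (A + q * Δ) := by
      rw [eq_div_iff hne, mul_assoc, add_mul, div_mul_cancel₀ _ hne]
      rw [hΔ]
      linear_combination hdet
    rw [← norm_mul, this, norm_div, div_le_iff₀ hpos]
    exact c1
  by_cases c2 : ‖k‖ ≤ 2 * ‖D + p * Δ‖
  · right; left
    have hpos : 0 < ‖D + p * Δ‖ := by linarith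
    have hne : D + p * Δ ≠ 0 := norm_pos_iff.1 hpos
    have : g * (q + (1 + p * A) / (D + p * Δ)) = k / (D + p * Δ) := by
      rw [eq_div_iff hne, mul_assoc, add_mul, div_mul_cancel₀ _ hne]
      rw [hΔ]
      linear_combination hdet
    rw [← norm_mul, this, norm_div, div_le_iff₀ hpos]
    exact c2
  right; right
  rw [not_le] at c1 c2
  -- The product `(A + q Δ)(D + p Δ)` equals `k²` plus `Δ` times the Cramer determinant. When both
  -- factors are below `‖k‖ / 2`, this forces `‖g‖ ‖k‖` to be of order at most `‖Δ‖`.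
  have e1 : g * (k * k) = g * ((A + q * Δ) * (D + p * Δ)) - Δ * k := by
    rw [hΔ]
    linear_combination (-(A * D - k * k)) * hdet
  have e2 : ‖g‖ * (‖k‖ * ‖k‖) ≤ ‖g‖ * (‖A + q * Δ‖ * ‖D + p * Δ‖) + ‖Δ‖ * ‖k‖ := by
    rw [← norm_mul, ← norm_mul, ← norm_mul, ← norm_mul, ← norm_mul, e1]
    exact norm_sub_le _ _
  have e3 : ‖A + q * Δ‖ * ‖D + p * Δ‖ ≤ (‖k‖ / 2) * (‖k‖ / 2) :=
    mul_le_mul (by linarith) (by linarith) (norm_nonneg _) (by positivity)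
  have e4 : ‖g‖ * ‖k‖ * (3 / 4) ≤ ‖Δ‖ := by
    have := mul_le_mul_of_nonneg_left e3 (norm_nonneg g)
    refine le_of_mul_le_mul_right ?_ hk0
    nlinarith
  have hg0 : 0 < ‖g‖ := by
    refine norm_pos_iff.2 fun hc => hk ?_
    rw [← hdet, hc, zero_mul]
  have hΔ0 : 0 < ‖Δ‖ := lt_of_lt_of_le (by positivity) e4
  have hne : Δ ≠ 0 := norm_pos_iff.1 hΔ0
  have e5 : q + A / Δ = (A + q * Δ) / Δ := by
    field_simp
    ring
  rw [e5, norm_div, ← mul_div_assoc, div_le_iff₀ hΔ0]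
  have := mul_le_mul_of_nonneg_left c1.le (norm_nonneg g)
  nlinarith

theorem enorm_rpow_le_of_norm_mul_le {a b : ℂ} (h : ‖a‖ * ‖b‖ ≤ 2) {t : ℝ} (ht : 0 < t) :
    ‖a‖ₑ ^ t ≤ 2 ^ t * ‖b‖ₑ⁻¹ ^ t := by
  rw [← ENNReal.mul_rpow_of_nonneg _ _ ht.le]
  refine ENNReal.rpow_le_rpow ?_ ht.le
  rw [← div_eq_mul_inv, ENNReal.le_div_iff_mul_le (Or.inr (by simp)) (Or.inl enorm_ne_top),
    ← enorm_mul, ← ofReal_norm, norm_mul]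
  exact ENNReal.ofReal_le_of_le_toReal (by simpa using h)

/-- The a priori bound on fractional moments of finite-volume Green functions. -/
theorem IsRegularPotential.exists_fracMoment_le {d : ℕ} {Ω : Type*} [MeasurableSpace Ω]
    {P : Measure Ω} [IsProbabilityMeasure P] {V : Site d → Ω → ℝ} (hV : IsRegularPotential P V)
    {lam : ℝ} (hlam : 0 < lam) {t : ℝ} (ht0 : 0 < t) (ht1 : t < 1) :
    ∃ K : ℝ≥0∞, K ≠ ∞ ∧ ∀ (Λ : Finset (Site d)) (z : ℂ), z.im ≠ 0 → ∀ x y : Site d,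
      fracMoment P V lam t (Λ : Set (Site d)) z x y ≤ K := by
  obtain ⟨K, hK, hb⟩ := hV.exists_lintegral_le hlam ht0 ht1
  have h2t : (2 : ℝ≥0∞) ^ t ≠ ∞ := by simp
  refine ⟨2 ^ t * (K + (K + K)), by finiteness, fun Λ z hz x y => ?_⟩
  have hbdd : ∀ v : Site d → ℝ, BddOn (Λ : Set (Site d)) v := bddOn_of_finite Λ.finite_toSet
  let S : Finset (Site d) := {x, y}
  -- The potential is switched off at `x` and `y`, so `k` is a function of the other sites alone.
  let k : Site d → Site d → (Site d → ℝ) → ℂ := fun a b v =>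
    green (Λ : Set (Site d)) lam ((S : Set (Site d))ᶜ.indicator v) z a b
  have hkm : ∀ a b, Measurable (k a b) := by
    intro a b
    refine measurable_green_finset Λ (W := fun w v => (S : Set (Site d))ᶜ.indicator v w)
      (fun w => ?_) lam hz a b
    by_cases hw : w ∈ (S : Set (Site d))ᶜ
    · simp only [Set.indicator_of_mem hw]
      fun_prop
    · simp only [Set.indicator_of_notMem hw]
      fun_prop
  have hki : ∀ T : Finset (Site d), Λ \ S ⊆ T → ∀ a b v,
      k a b ((T : Set (Site d)).indicator v) = k a b v := by
    intro T hT a b v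
    refine green_congr (hbdd _) (fun w hw => ?_) lam z a b
    by_cases hwS : w ∈ S
    · simp [hwS]
    · have : w ∈ T := hT (Finset.mem_sdiff.2 ⟨hw, hwS⟩)
      simp [hwS, this]
  have hsym : ∀ a b v, k a b v = k b a v := fun a b v => green_symm (hbdd _) lam hz a b
  by_cases hxy : x ∈ Λ ∧ y ∈ Λ
  swap
  · have : ∀ ω, green (Λ : Set (Site d)) lam (fun w => V w ω) z x y = 0 := fun ω => by
      rw [green, dif_neg (by simpa using hxy)]
    simp [fracMoment, this, ht0]
  rcases eq_or_ne x y with rfl | hne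
  -- On the diagonal the rank-one formula is `g = 1 / (lam V x + 1 / k)` when `k` does not vanish;
  -- otherwise `g = 0`.
  · have hpt : ∀ ω, ‖green (Λ : Set (Site d)) lam (fun w => V w ω) z x x‖ₑ ^ t ≤
        2 ^ t * ‖(lam : ℂ) * (V x ω : ℝ) + (k x x fun w => V w ω)⁻¹‖ₑ⁻¹ ^ t := by
      intro ω
      refine enorm_rpow_le_of_norm_mul_le ?_ ht0
      have h1 := green_eq_sub_sum (hbdd fun w => V w ω) lam hz S x x
      have hS : S = {x} := by simp [S]
      have h2 : ∀ f : Site d → ℂ, ∑ s ∈ S, f s = f x := fun f => by rw [hS, Finset.sum_singleton]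
      rw [h2] at h1
      change _ = k x x (fun w => V w ω) - _ * k x x (fun w => V w ω) * _ at h1
      rw [← norm_mul]
      generalize k x x (fun w => V w ω) = A at *
      generalize green (Λ : Set (Site d)) lam (fun w => V w ω) z x x = g at *
      by_cases hA : A = 0
      · simp [hA] at h1
        simp [h1]
      · have : g * (lam * (V x ω : ℝ) + A⁻¹) = 1 := by
          field_simp
          linear_combination h1
        rw [this]
        simp
    calc _ ≤ ∫⁻ ω, 2 ^ t * ‖(lam : ℂ) * (V x ω : ℝ) + (k x x fun w => V w ω)⁻¹‖ₑ⁻¹ ^ t ∂P :=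
          lintegral_mono hpt
      _ = 2 ^ t * ∫⁻ ω, ‖(lam : ℂ) * (V x ω : ℝ) + (k x x fun w => V w ω)⁻¹‖ₑ⁻¹ ^ t ∂P :=
          lintegral_const_mul' _ _ h2t
      _ ≤ 2 ^ t * K := by
          gcongr
          refine hb x (Λ \ S) (by simp [S]) (fun v => (k x x v)⁻¹) (hkm x x).inv fun v => ?_
          rw [hki _ subset_rfl]
      _ ≤ _ := by gcongr; exact le_self_add
  let Δ : (Site d → ℝ) → ℂ := fun v => k x x v * k y y v - k x y v * k x y v
  have hΔm : Measurable Δ := ((hkm _ _).mul (hkm _ _)).sub ((hkm _ _).mul (hkm _ _))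
  let c1 : (Site d → ℝ) → ℂ := fun v => (1 + lam * (v y : ℝ) * k y y v) /
    (k x x v + lam * (v y : ℝ) * Δ v)
  let c2 : (Site d → ℝ) → ℂ := fun v => (1 + lam * (v x : ℝ) * k x x v) /
    (k y y v + lam * (v x : ℝ) * Δ v)
  let c3 : (Site d → ℝ) → ℂ := fun v => k x x v / Δ v
  have hc1 : Measurable c1 := by
    have := hkm x x
    have := hkm y y
    fun_prop
  have hc2 : Measurable c2 := by
    have := hkm x x
    have := hkm y y
    fun_prop
  have hc3 : Measurable c3 := (hkm _ _).div hΔm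
  let f1 : Ω → ℝ≥0∞ := fun ω => ‖(lam : ℂ) * (V x ω : ℝ) + c1 (fun w => V w ω)‖ₑ⁻¹ ^ t
  let f2 : Ω → ℝ≥0∞ := fun ω => ‖(lam : ℂ) * (V y ω : ℝ) + c2 (fun w => V w ω)‖ₑ⁻¹ ^ t
  let f3 : Ω → ℝ≥0∞ := fun ω => ‖(lam : ℂ) * (V y ω : ℝ) + c3 (fun w => V w ω)‖ₑ⁻¹ ^ t
  have hVm : Measurable fun ω => fun w => V w ω := measurable_pi_lambda _ hV.measurable
  have hf1 : Measurable f1 :=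
    (((Complex.measurable_ofReal.comp (hV.measurable x)).const_mul _).add
      (hc1.comp hVm)).enorm.inv.pow_const t
  have hf2 : Measurable f2 :=
    (((Complex.measurable_ofReal.comp (hV.measurable y)).const_mul _).add
      (hc2.comp hVm)).enorm.inv.pow_const t
  have hpt : ∀ ω, ‖green (Λ : Set (Site d)) lam (fun w => V w ω) z x y‖ₑ ^ t ≤
      2 ^ t * (f1 ω + (f2 ω + f3 ω)) := by
    intro ω
    have hG : ∀ a b, green (Λ : Set (Site d)) lam (fun w => V w ω) z a b =
        k a b (fun w => V w ω) -
        (lam * (V x ω : ℝ) * k a x (fun w => V w ω) *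
          green (Λ : Set (Site d)) lam (fun w => V w ω) z x b +
        lam * (V y ω : ℝ) * k a y (fun w => V w ω) *
          green (Λ : Set (Site d)) lam (fun w => V w ω) z y b) := by
      intro a b
      have h1 := green_eq_sub_sum (hbdd fun w => V w ω) lam hz S a b
      have h2 : ∀ f : Site d → ℂ, ∑ s ∈ S, f s = f x + f y := fun f => by
        simp only [S]
        rw [Finset.sum_pair hne]
      rw [h2] at h1
      exact h1
    have e1 := hG x y
    have e2 := hG y y
    rw [hsym y x] at e2
    rcases norm_mul_le_of_two_site e1 e2 (hG x x) with h | h | h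
    · refine (enorm_rpow_le_of_norm_mul_le h ht0).trans ?_
      exact mul_le_mul_right (le_self_add (a := f1 ω)) _
    · refine (enorm_rpow_le_of_norm_mul_le h ht0).trans ?_
      exact mul_le_mul_right ((le_self_add (a := f2 ω)).trans le_add_self) _
    · refine (enorm_rpow_le_of_norm_mul_le h ht0).trans ?_
      exact mul_le_mul_right ((le_add_self (a := f3 ω)).trans le_add_self) _
  calc _ ≤ ∫⁻ ω, 2 ^ t * (f1 ω + (f2 ω + f3 ω)) ∂P := lintegral_mono hpt
    _ = 2 ^ t * (∫⁻ ω, f1 ω ∂P + (∫⁻ ω, f2 ω ∂P + ∫⁻ ω, f3 ω ∂P)) := by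
        rw [lintegral_const_mul' _ _ h2t, lintegral_add_left hf1, lintegral_add_left hf2]
    _ ≤ _ := by
        -- The offset `c1` may involve the potential at `y` but not at `x`, and symmetrically for
        -- `c2`.
        have hyx : y ∈ Λ.erase x := Finset.mem_erase.2 ⟨hne.symm, hxy.2⟩
        have hxy' : x ∈ Λ.erase y := Finset.mem_erase.2 ⟨hne, hxy.1⟩
        have s1 : Λ \ S ⊆ Λ.erase x := fun w hw => by
          simp only [S, Finset.mem_sdiff, Finset.mem_insert, Finset.mem_singleton, not_or] at hw
          exact Finset.mem_erase.2 ⟨hw.2.1, hw.1⟩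
        have s2 : Λ \ S ⊆ Λ.erase y := fun w hw => by
          simp only [S, Finset.mem_sdiff, Finset.mem_insert, Finset.mem_singleton, not_or] at hw
          exact Finset.mem_erase.2 ⟨hw.2.2, hw.1⟩
        gcongr
        · refine hb x (Λ.erase x) (by simp) c1 hc1 fun v => ?_
          simp only [c1, Δ, hki _ s1]
          rw [Set.indicator_of_mem (by exact_mod_cast hyx)]
        · refine hb y (Λ.erase y) (by simp) c2 hc2 fun v => ?_
          simp only [c2, Δ, hki _ s2]
          rw [Set.indicator_of_mem (by exact_mod_cast hxy')]
        · refine hb y (Λ.erase y) (by simp) c3 hc3 fun v => ?_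
          simp only [c3, Δ, hki _ s2]

end APriori

/-! ### From infinite-volume decay to finite-volume moments, and the limit to real energy. -/

section FiniteVolume

open Filter Topology

variable {d : ℕ} {Ω : Type*} [MeasurableSpace Ω] {P : Measure Ω} {V : Site d → Ω → ℝ}

theorem enorm_sub_sum_rpow_le {ι : Type*} (t : Finset ι) (a : ℂ) (f : ι → ℂ) {r : ℝ} (hr0 : 0 < r)
    (hr1 : r ≤ 1) : ‖a - ∑ i ∈ t, f i‖ₑ ^ r ≤ ‖a‖ₑ ^ r + ∑ i ∈ t, ‖f i‖ₑ ^ r := by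
  classical
  have hadd : ∀ b c : ℂ, ‖b + c‖ₑ ^ r ≤ ‖b‖ₑ ^ r + ‖c‖ₑ ^ r := fun b c =>
    (ENNReal.rpow_le_rpow (enorm_add_le b c) hr0.le).trans
      (ENNReal.rpow_add_le_add_rpow _ _ hr0.le hr1)
  have hsum : ‖∑ i ∈ t, f i‖ₑ ^ r ≤ ∑ i ∈ t, ‖f i‖ₑ ^ r := by
    induction t using Finset.induction_on with
    | empty => simp [hr0]
    | insert i t hi ih =>
      rw [Finset.sum_insert hi, Finset.sum_insert hi]
      exact (hadd _ _).trans (by gcongr)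
  rw [sub_eq_add_neg]
  refine (hadd _ _).trans ?_
  rw [enorm_neg]
  gcongr

theorem lintegral_rpow_half_mul_le {f g : Ω → ℝ≥0∞} (hf : AEMeasurable f P) (hg : AEMeasurable g P)
    {s : ℝ} : ∫⁻ ω, f ω ^ (s / 2) * g ω ^ (s / 2) ∂P ≤
      (∫⁻ ω, f ω ^ s ∂P) ^ (1 / 2 : ℝ) * (∫⁻ ω, g ω ^ s ∂P) ^ (1 / 2 : ℝ) := by
  have := ENNReal.lintegral_mul_norm_pow_le (hf.pow_const s) (hg.pow_const s)
    (p := 1 / 2) (q := 1 / 2) (by norm_num) (by norm_num) (by norm_num)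
  simpa only [← ENNReal.rpow_mul, mul_one_div] using this

/-- Half of the moments of a finite-volume Green function decay as the infinite-volume one. -/
theorem IsRegularPotential.fracMoment_half_le [IsProbabilityMeasure P]
    (hV : IsRegularPotential P V) (Λ : Finset (Site d)) (lam : ℝ) {z : ℂ} (hz : z.im ≠ 0)
    {s : ℝ} (hs0 : 0 < s) (hs1 : s < 1) {x u : Site d} (hu : u ∈ Λ) {ε K : ℝ≥0∞}
    (h0 : fracMoment P V lam s Set.univ z x u ≤ ε)
    (h1 : ∀ b ∈ boundaryBonds Λ, fracMoment P V lam s Set.univ z x b.2 ≤ ε)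
    (hK : ∀ w, fracMoment P V lam s (Λ : Set (Site d)) z w u ≤ K) :
    fracMoment P V lam (s / 2) (Λ : Set (Site d)) z x u ≤
      ε ^ (1 / 2 : ℝ) * (1 + (boundaryBonds Λ).card * K ^ (1 / 2 : ℝ)) := by
  let G : Site d → Ω → ℝ≥0∞ := fun y ω => ‖green Set.univ lam (fun w => V w ω) z x y‖ₑ
  let GΛ : Site d → Ω → ℝ≥0∞ := fun w ω => ‖green (Λ : Set (Site d)) lam (fun w => V w ω) z w u‖ₑ
  have hG : ∀ y, AEMeasurable (G y) P := fun y =>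
    (aemeasurable_green Set.univ hV.measurable (hV.ae_bddOn _) lam hz x y).enorm
  have hGΛ : ∀ w, AEMeasurable (GΛ w) P := fun w =>
    (measurable_green_finset Λ hV.measurable lam hz w u).enorm.aemeasurable
  have hr0 : 0 < s / 2 := by linarith
  calc fracMoment P V lam (s / 2) (Λ : Set (Site d)) z x u
      ≤ ∫⁻ ω, (G u ω ^ (s / 2) +
          ∑ b ∈ boundaryBonds Λ, G b.2 ω ^ (s / 2) * GΛ b.1 ω ^ (s / 2)) ∂P := by
        refine lintegral_mono_ae ?_
        filter_upwards [hV.ae_bddOn Set.univ] with ω hω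
        rw [green_finset_eq Λ hω lam hz x u hu]
        refine (enorm_sub_sum_rpow_le _ _ _ hr0 (by linarith)).trans ?_
        simp only [enorm_mul, ENNReal.mul_rpow_of_nonneg _ _ hr0.le]
        rfl
    _ = ∫⁻ ω, G u ω ^ (s / 2) ∂P +
          ∑ b ∈ boundaryBonds Λ, ∫⁻ ω, G b.2 ω ^ (s / 2) * GΛ b.1 ω ^ (s / 2) ∂P := by
        rw [lintegral_add_left' ((hG u).pow_const _), lintegral_finsetSum']
        exact fun b _ => ((hG _).pow_const _).mul ((hGΛ _).pow_const _)
    _ ≤ ε ^ (1 / 2 : ℝ) + ∑ b ∈ boundaryBonds Λ, ε ^ (1 / 2 : ℝ) * K ^ (1 / 2 : ℝ) := by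
        refine add_le_add ?_ (Finset.sum_le_sum fun b hb => ?_)
        -- Cauchy-Schwarz against the constant 1, since `P` has total mass one.
        · have := lintegral_rpow_half_mul_le (s := s) (hG u) (aemeasurable_const (b := 1))
          simp only [ENNReal.one_rpow, mul_one, lintegral_one, measure_univ] at this
          exact this.trans (ENNReal.rpow_le_rpow h0 (by norm_num))
        · exact (lintegral_rpow_half_mul_le (hG _) (hGΛ _)).trans
            (mul_le_mul' (ENNReal.rpow_le_rpow (h1 b hb) (by norm_num))
              (ENNReal.rpow_le_rpow (hK b.1) (by norm_num)))
    _ = _ := by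
        rw [Finset.sum_const, nsmul_eq_mul]
        ring

/-- Hölder with weights `1 - s` and `s`, since `s = (1 - s) * (s / 2) + s * ((1 + s) / 2)`. -/
theorem fracMoment_le_interpolation (hV : ∀ x, Measurable (V x)) (Λ : Finset (Site d)) (lam : ℝ)
    {z : ℂ} (hz : z.im ≠ 0) {s : ℝ} (hs0 : 0 < s) (hs1 : s < 1) (x y : Site d) :
    fracMoment P V lam s (Λ : Set (Site d)) z x y ≤
      fracMoment P V lam (s / 2) (Λ : Set (Site d)) z x y ^ (1 - s) *
        fracMoment P V lam ((1 + s) / 2) (Λ : Set (Site d)) z x y ^ s := by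
  have hm := (measurable_green_finset Λ hV lam hz x y).enorm.aemeasurable (μ := P)
  refine le_trans (lintegral_mono fun ω => ?_) (ENNReal.lintegral_mul_norm_pow_le
    (hm.pow_const (s / 2)) (hm.pow_const ((1 + s) / 2)) (sub_nonneg.2 hs1.le) hs0.le (by ring))
  dsimp only
  have h1 : 0 ≤ s / 2 * (1 - s) := mul_nonneg (by linarith) (by linarith)
  have h2 : 0 ≤ (1 + s) / 2 * s := mul_nonneg (by linarith) (by linarith)
  rw [← ENNReal.rpow_mul, ← ENNReal.rpow_mul, ← ENNReal.rpow_add_of_nonneg _ _ h1 h2]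
  refine le_of_eq ?_
  congr 1
  ring

/-- Where `H - E` is invertible the Green function is continuous in the energy; elsewhere
`Ring.inverse` is zero and nothing is to be shown. No almost sure invertibility at real `E` is
needed. -/
theorem enorm_green_le_liminf (Λ : Set (Site d)) (lam : ℝ) (v : Site d → ℝ) (E : ℂ) {w : ℕ → ℂ}
    (hw : Tendsto w atTop (𝓝 E)) {s : ℝ} (hs : 0 < s) (x y : Site d) :
    ‖green Λ lam v E x y‖ₑ ^ s ≤ liminf (fun n => ‖green Λ lam v (w n) x y‖ₑ ^ s) atTop := by
  by_cases hxy : x ∈ Λ ∧ y ∈ Λ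
  swap
  · simp [green, hxy, hs]
  by_cases hE : IsUnit (shifted Λ lam v E)
  · refine le_of_eq (Tendsto.liminf_eq ?_).symm
    refine (ENNReal.continuous_rpow_const.tendsto _).comp ?_
    refine (continuous_enorm.tendsto _).comp ?_
    simp only [green, dif_pos hxy]
    obtain ⟨U, hU⟩ := hE
    have h1 := (NormedRing.inverse_continuousAt U).tendsto
    rw [hU] at h1
    have h2 : Tendsto (fun n => shifted Λ lam v (w n)) atTop (𝓝 (shifted Λ lam v E)) :=
      tendsto_const_nhds.sub (((algebraMapCLM ℂ (EllTwo Λ →L[ℂ] EllTwo Λ)).continuous.tendsto E).comp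
        hw)
    have h3 : Continuous fun T : EllTwo Λ →L[ℂ] EllTwo Λ =>
        T (lp.single 2 (⟨y, hxy.2⟩ : Λ) (1 : ℂ)) ⟨x, hxy.1⟩ :=
      (continuous_eval_site _).comp (continuous_id.clm_apply continuous_const)
    exact (h3.tendsto _).comp (h1.comp h2)
  · rw [green, dif_pos hxy, Ring.inverse_non_unit _ hE]
    simp [hs]

theorem fracMoment_le_of_forall_im_ne_zero (hV : ∀ x, Measurable (V x)) (Λ : Finset (Site d))
    (lam : ℝ) {s : ℝ} (hs : 0 < s) {E : ℂ} (hE : E.im = 0) (x y : Site d) {B : ℝ≥0∞}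
    (hB : ∀ η : ℝ, η ≠ 0 →
      fracMoment P V lam s (Λ : Set (Site d)) (E + η * Complex.I) x y ≤ B) :
    fracMoment P V lam s (Λ : Set (Site d)) E x y ≤ B := by
  let η : ℕ → ℝ := fun n => 1 / ((n : ℝ) + 1)
  have hη : ∀ n, η n ≠ 0 := fun n => Nat.one_div_pos_of_nat.ne'
  have hw : Tendsto (fun n => E + η n * Complex.I) atTop (𝓝 E) := by
    have h1 : Tendsto (fun n => (η n : ℂ)) atTop (𝓝 ((0 : ℝ) : ℂ)) :=
      (Complex.continuous_ofReal.tendsto 0).comp tendsto_one_div_add_atTop_nhds_zero_nat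
    simpa using (h1.mul_const Complex.I).const_add E
  calc fracMoment P V lam s (Λ : Set (Site d)) E x y
      ≤ ∫⁻ ω, liminf (fun n => ‖green (Λ : Set (Site d)) lam (fun w => V w ω)
          (E + η n * Complex.I) x y‖ₑ ^ s) atTop ∂P :=
        lintegral_mono fun ω => enorm_green_le_liminf _ lam _ E hw hs x y
    _ ≤ liminf (fun n => fracMoment P V lam s (Λ : Set (Site d)) (E + η n * Complex.I) x y)
          atTop := by
        refine lintegral_liminf_le fun n => ?_
        have him : (E + η n * Complex.I).im ≠ 0 := by simpa [hE] using hη n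
        exact (measurable_green_finset Λ hV lam him x y).enorm.pow_const s
    _ ≤ B := by
        refine (liminf_le_liminf (Eventually.of_forall fun n => hB (η n) (hη n))).trans ?_
        simp

end FiniteVolume

/-! ### Boundary of the cube, and exponential decay against polynomial growth. -/

section Geometry

variable {d : ℕ}

theorem abs_sub_le_siteDist (x y : Site d) (j : Fin d) : |(x j : ℝ) - y j| ≤ siteDist x y := by
  refine Real.abs_le_sqrt ?_
  exact Finset.single_le_sum (f := fun j => ((x j : ℝ) - y j) ^ 2) (fun _ _ => sq_nonneg _)
    (Finset.mem_univ j)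

theorem le_siteDist_of_mem_boundaryBonds {L : ℕ} {b : Site d × Site d}
    (hb : b ∈ boundaryBonds (cube d L)) :
    (L : ℝ) ≤ siteDist 0 b.1 ∧ (L : ℝ) ≤ siteDist 0 b.2 := by
  rw [mem_boundaryBonds] at hb
  obtain ⟨-, hstep, hnot⟩ := hb
  have hj : ∃ j, (L : ℤ) < |b.2 j| := by
    by_contra! hc
    refine hnot (Finset.mem_Icc.2 ⟨fun j => (abs_le.1 (hc j)).1, fun j => (abs_le.1 (hc j)).2⟩)
  obtain ⟨j, hj⟩ := hj
  simp only [unitSteps, Finset.mem_filter, Finset.mem_Icc] at hstep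
  have h1 : |b.2 j - b.1 j| ≤ 1 := abs_le.2 ⟨hstep.1.1 j, hstep.1.2 j⟩
  have h2 : |b.2 j| ≤ |b.2 j - b.1 j| + |b.1 j| := by
    simpa using abs_add_le (b.2 j - b.1 j) (b.1 j)
  have key : ∀ x : Site d, (L : ℤ) ≤ |x j| → (L : ℝ) ≤ siteDist 0 x := by
    intro x hx
    have h3 := abs_sub_le_siteDist 0 x j
    have h4 : (L : ℝ) ≤ |(x j : ℝ)| := by exact_mod_cast hx
    simp only [Pi.zero_apply, Int.cast_zero, zero_sub, abs_neg] at h3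
    exact h4.trans h3
  exact ⟨key _ (by linarith), key _ (by linarith)⟩

theorem card_boundaryBonds_cube_le (d L : ℕ) :
    (boundaryBonds (cube d L)).card ≤ (2 * L + 1) ^ d * 3 ^ d := by
  refine (Finset.card_filter_le _ _).trans (Finset.card_image_le.trans ?_)
  rw [Finset.card_product]
  refine Nat.mul_le_mul (le_of_eq ?_) ((Finset.card_filter_le _ _).trans (le_of_eq ?_))
  · rw [cube, Pi.card_Icc]
    simp only [Int.card_Icc, Finset.prod_const, Finset.card_univ, Fintype.card_fin]
    congr 1
    omega
  · rw [Pi.card_Icc]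
    simp

theorem exists_pow_mul_le_exp (d : ℕ) {δ : ℝ} (hδ : 0 < δ) :
    ∃ D : ℝ, 1 ≤ D ∧ ∀ L : ℕ, (((2 * L + 1) ^ d * 3 ^ d : ℕ) : ℝ) ≤ D * Real.exp (δ * L) := by
  -- Each of the `d` linear factors spends rate `c`; the `+ 1` keeps the denominator nonzero for `d
  -- = 0`.
  let c : ℝ := δ / (d + 1)
  have hc : 0 < c := by positivity
  have hcd : c * d ≤ δ := by
    simp only [c]
    rw [div_mul_eq_mul_div, div_le_iff₀ (by positivity)]
    nlinarith
  let D₀ : ℝ := 2 / c + 1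
  have hD₀ : 1 ≤ D₀ := by
    have : 0 < 2 / c := by positivity
    simp only [D₀]
    linarith
  refine ⟨D₀ ^ d * 3 ^ d, one_le_mul_of_one_le_of_one_le (one_le_pow₀ hD₀)
    (one_le_pow₀ (by norm_num)), fun L => ?_⟩
  have h1 : (2 * L + 1 : ℝ) ≤ D₀ * Real.exp (c * L) := by
    have h2 := Real.add_one_le_exp (c * L)
    have h3 : (2 * L + 1 : ℝ) ≤ D₀ * (c * L + 1) := by
      have h4 : D₀ * (c * L + 1) = 2 * L + 1 + (2 / c + c * L) := by
        simp only [D₀]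
        field_simp
        ring
      rw [h4]
      have : 0 ≤ 2 / c + c * L := by positivity
      linarith
    exact h3.trans (mul_le_mul_of_nonneg_left h2 (by linarith))
  push_cast
  calc (2 * L + 1 : ℝ) ^ d * 3 ^ d ≤ (D₀ * Real.exp (c * L)) ^ d * 3 ^ d := by gcongr
    _ = D₀ ^ d * 3 ^ d * Real.exp (c * d * L) := by
        rw [mul_pow, ← Real.exp_nat_mul]
        ring_nf
    _ ≤ D₀ ^ d * 3 ^ d * Real.exp (δ * L) := by gcongr

theorem eventually_mul_rpow_lt_one (d : ℕ) {a c k k' s μ : ℝ} (ha : 0 ≤ a) (hc : 0 ≤ c)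
    (hk : 0 ≤ k) (hk' : 0 ≤ k') (hs0 : 0 < s) (hs1 : s < 1) (hμ : 0 < μ) :
    ∃ L₀ : ℕ, ∀ L : ℕ, L₀ ≤ L → ∀ N : ℕ, N ≤ (2 * L + 1) ^ d * 3 ^ d →
      (1 + c * N) ^ 2 * (N * ((a * Real.exp (-μ * L) * (1 + N * k)) ^ (1 - s) * k')) < 1 := by
  have hs : 0 < 1 - s := by linarith
  -- Four factors `exp (δ L)` occur: two from the square, one from the number of bonds, one from the
  -- interpolated factor. Together they use half of the rate `μ (1 - s)`.
  let δ : ℝ := μ * (1 - s) / 8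
  have hδ : 0 < δ := by positivity
  obtain ⟨D, hD, hDL⟩ := exists_pow_mul_le_exp d hδ
  let M : ℝ := (1 + c) ^ 2 * D ^ 3 * ((a * (1 + k) * D) ^ (1 - s) * k')
  have hM : 0 ≤ M := by positivity
  have hlim : Filter.Tendsto (fun L : ℕ => M * Real.exp (-(μ * (1 - s) / 2) * L)) Filter.atTop
      (nhds 0) := by
    have h1 : Filter.Tendsto (fun L : ℕ => -(μ * (1 - s) / 2) * (L : ℝ)) Filter.atTop
        Filter.atBot :=
      tendsto_natCast_atTop_atTop.const_mul_atTop_of_neg (by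
        have : 0 < μ * (1 - s) / 2 := by positivity
        linarith)
    simpa using (Real.tendsto_exp_atBot.comp h1).const_mul M
  obtain ⟨L₀, hL₀⟩ := Filter.eventually_atTop.1 (hlim.eventually_lt_const zero_lt_one)
  refine ⟨L₀, fun L hL N hN => lt_of_le_of_lt ?_ (hL₀ L hL)⟩
  let X : ℝ := Real.exp (δ * L)
  have hX : 1 ≤ X := Real.one_le_exp (by positivity)
  have hNX : (N : ℝ) ≤ D * X := le_trans (by exact_mod_cast hN) (hDL L)
  have hDX : 1 ≤ D * X := one_le_mul_of_one_le_of_one_le hD hX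
  have e1 : 1 + c * N ≤ (1 + c) * (D * X) := by nlinarith
  have e2 : 1 + N * k ≤ (1 + k) * (D * X) := by nlinarith
  have e3 : X ^ (1 - s) ≤ X := by
    simpa using Real.rpow_le_rpow_of_exponent_le hX (show 1 - s ≤ 1 by linarith)
  calc (1 + c * N) ^ 2 * (N * ((a * Real.exp (-μ * L) * (1 + N * k)) ^ (1 - s) * k'))
      ≤ ((1 + c) * (D * X)) ^ 2 * ((D * X) *
          ((a * Real.exp (-μ * L) * ((1 + k) * (D * X))) ^ (1 - s) * k')) := by gcongr
    _ = (1 + c) ^ 2 * D ^ 3 * X ^ 3 *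
          ((a * (1 + k) * D) ^ (1 - s) * Real.exp (-μ * L) ^ (1 - s) * X ^ (1 - s) * k') := by
        rw [show a * Real.exp (-μ * L) * ((1 + k) * (D * X)) =
          (a * (1 + k) * D) * Real.exp (-μ * L) * X by ring,
          Real.mul_rpow (by positivity) (by positivity),
          Real.mul_rpow (by positivity) (by positivity)]
        ring
    _ ≤ (1 + c) ^ 2 * D ^ 3 * X ^ 3 *
          ((a * (1 + k) * D) ^ (1 - s) * Real.exp (-μ * L) ^ (1 - s) * X * k') := by gcongr
    _ = M * (X ^ 4 * Real.exp (-μ * L) ^ (1 - s)) := by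
        simp only [M]
        ring
    _ = M * Real.exp (-(μ * (1 - s) / 2) * L) := by
        rw [← Real.exp_mul, ← Real.exp_nat_mul, ← Real.exp_add]
        congr 2
        simp only [δ]
        push_cast
        ring

end Geometry

/-! ### Assembly of the estimates on the cube. -/

theorem IsRegularPotential.fracMoment_cube_le {d : ℕ} {Ω : Type*} [MeasurableSpace Ω]
    {P : Measure Ω} [IsProbabilityMeasure P] {V : Site d → Ω → ℝ} (hV : IsRegularPotential P V)
    {lam s : ℝ} (hs0 : 0 < s) (hs1 : s < 1) {z : ℂ} (hz : z.im ≠ 0)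
    {A μ : ℝ} (hμ : 0 < μ) (hloc : ∀ x y : Site d, fracMoment P V lam s Set.univ z x y ≤
      ENNReal.ofReal (A * Real.exp (-μ * siteDist x y))) {L : ℕ} {K K' : ℝ≥0}
    (hK : ∀ x y, fracMoment P V lam s (cube d L : Set (Site d)) z x y ≤ K)
    (hK' : ∀ x y, fracMoment P V lam ((1 + s) / 2) (cube d L : Set (Site d)) z x y ≤ K')
    {b : Site d × Site d} (hb : b ∈ boundaryBonds (cube d L)) :
    fracMoment P V lam s (cube d L : Set (Site d)) z 0 b.1 ≤
      ENNReal.ofReal ((|A| ^ (1 / 2 : ℝ) * Real.exp (-(μ / 2) * L) *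
        (1 + (boundaryBonds (cube d L)).card * (K : ℝ) ^ (1 / 2 : ℝ))) ^ (1 - s) *
          (K' : ℝ) ^ s) := by
  have hε : ∀ y, (L : ℝ) ≤ siteDist 0 y → fracMoment P V lam s Set.univ z 0 y ≤
      ENNReal.ofReal (|A| * Real.exp (-μ * L)) := fun y hy => by
    refine (hloc 0 y).trans (ENNReal.ofReal_le_ofReal ?_)
    refine mul_le_mul (le_abs_self A) (Real.exp_le_exp.2 ?_) (Real.exp_pos _).le (abs_nonneg _)
    nlinarith
  have h1 := hV.fracMoment_half_le (cube d L) lam hz hs0 hs1 (mem_boundaryBonds.1 hb).1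
    (hε b.1 (le_siteDist_of_mem_boundaryBonds hb).1)
    (fun c hc => hε c.2 (le_siteDist_of_mem_boundaryBonds hc).2) (fun w => hK w b.1)
  have hs : 0 ≤ 1 - s := by linarith
  refine (fracMoment_le_interpolation hV.measurable (cube d L) lam hz hs0 hs1 0 b.1).trans ?_
  refine (mul_le_mul' (ENNReal.rpow_le_rpow h1 hs) (ENNReal.rpow_le_rpow (hK' 0 b.1) hs0.le)).trans
    (le_of_eq ?_)
  have hK1 : (K : ℝ≥0∞) ^ (1 / 2 : ℝ) = ENNReal.ofReal ((K : ℝ) ^ (1 / 2 : ℝ)) := by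
    rw [← ENNReal.ofReal_coe_nnreal, ENNReal.ofReal_rpow_of_nonneg K.coe_nonneg (by norm_num)]
  have hK1' : (K' : ℝ≥0∞) ^ s = ENNReal.ofReal ((K' : ℝ) ^ s) := by
    rw [← ENNReal.ofReal_coe_nnreal, ENNReal.ofReal_rpow_of_nonneg K'.coe_nonneg hs0.le]
  have hexp : (|A| * Real.exp (-μ * L)) ^ (1 / 2 : ℝ) =
      |A| ^ (1 / 2 : ℝ) * Real.exp (-(μ / 2) * L) := by
    rw [Real.mul_rpow (abs_nonneg _) (Real.exp_pos _).le, ← Real.exp_mul]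
    ring_nf
  rw [hK1, hK1', ENNReal.ofReal_rpow_of_nonneg (by positivity) (by norm_num), hexp,
    ← ENNReal.ofReal_natCast, ← ENNReal.ofReal_mul (by positivity), ← ENNReal.ofReal_one,
    ← ENNReal.ofReal_add zero_le_one (by positivity), ← ENNReal.ofReal_mul (by positivity),
    ENNReal.ofReal_rpow_of_nonneg (by positivity) hs, ← ENNReal.ofReal_mul (by positivity)]

end

theorem theorem3 {d : ℕ} {Ω : Type*} [MeasurableSpace Ω] (P : Measure Ω) [IsProbabilityMeasure P]
    (V : Site d → Ω → ℝ) (hV : IsRegularPotential P V)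
    (lam : ℝ) (hlam : 0 < lam) (s : ℝ) (hs0 : 0 < s) (hs1 : s < 1) (E : ℂ)
    (hloc : ∃ A μ : ℝ, 0 < μ ∧ FractionalMomentBound P V lam s E A μ) :
    ∀ C : ℝ, ∃ L₀ : ℕ, ∀ L : ℕ, L₀ ≤ L →
      FiniteVolumeCriterion P V lam s C E (cube d L) := by
  intro C
  obtain ⟨A, μ, hμ, hreal, hcomplex⟩ := hloc
  obtain ⟨K, hK, hKb⟩ := hV.exists_fracMoment_le hlam hs0 hs1
  obtain ⟨K', hK', hKb'⟩ := hV.exists_fracMoment_le hlam (t := (1 + s) / 2) (by linarith)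
    (by linarith)
  lift K to ℝ≥0 using hK
  lift K' to ℝ≥0 using hK'
  -- The rate is `μ / 2` and the amplitude `|A| ^ (1 / 2)` because Cauchy-Schwarz took a square
  -- root. Absolute values cover `A` and `C` of either sign.
  obtain ⟨L₀, hL₀⟩ := eventually_mul_rpow_lt_one d (a := |A| ^ (1 / 2 : ℝ)) (c := |C / lam ^ s|)
    (k := (K : ℝ) ^ (1 / 2 : ℝ)) (k' := (K' : ℝ) ^ s) (by positivity) (abs_nonneg _)
    (by positivity) (by positivity) hs0 hs1 (half_pos hμ)
  refine ⟨L₀, fun L hL => ?_⟩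
  set N := (boundaryBonds (cube d L)).card with hN
  set B : ℝ := (|A| ^ (1 / 2 : ℝ) * Real.exp (-(μ / 2) * L) *
    (1 + N * (K : ℝ) ^ (1 / 2 : ℝ))) ^ (1 - s) * (K' : ℝ) ^ s with hB
  have hB0 : 0 ≤ B := by positivity
  have hmoment : ∀ b ∈ boundaryBonds (cube d L),
      fracMoment P V lam s (cube d L : Set (Site d)) E 0 b.1 ≤ ENNReal.ofReal B := by
    intro b hb
    by_cases hE : E.im = 0
    · refine fracMoment_le_of_forall_im_ne_zero hV.measurable _ lam hs0 hE _ _ fun η hη => ?_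
      have hz : (E + η * Complex.I).im ≠ 0 := by simpa [hE] using hη
      exact hV.fracMoment_cube_le hs0 hs1 hz hμ (hreal hE η hη) (hKb _ _ hz) (hKb' _ _ hz) hb
    · exact hV.fracMoment_cube_le hs0 hs1 hE hμ (hcomplex hE) (hKb _ _ hE) (hKb' _ _ hE) hb
  have hsq : (1 + C / lam ^ s * (N : ℝ)) ^ 2 ≤ (1 + |C / lam ^ s| * N) ^ 2 := by
    refine sq_le_sq' ?_ ?_
    · nlinarith [neg_abs_le (C / lam ^ s), Nat.cast_nonneg (α := ℝ) N]
    · nlinarith [le_abs_self (C / lam ^ s), Nat.cast_nonneg (α := ℝ) N]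
  calc ENNReal.ofReal ((1 + C / lam ^ s * (N : ℝ)) ^ 2) * ∑ b ∈ boundaryBonds (cube d L),
        fracMoment P V lam s (cube d L : Set (Site d)) E 0 b.1
      ≤ ENNReal.ofReal ((1 + |C / lam ^ s| * N) ^ 2) * (N * ENNReal.ofReal B) := by
        gcongr
        refine (Finset.sum_le_card_nsmul _ _ _ hmoment).trans_eq ?_
        rw [nsmul_eq_mul]
    _ = ENNReal.ofReal ((1 + |C / lam ^ s| * N) ^ 2 * (N * B)) := by
        rw [← ENNReal.ofReal_natCast, ← ENNReal.ofReal_mul (by positivity),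
          ← ENNReal.ofReal_mul (by positivity)]
    _ < 1 := by
        rw [ENNReal.ofReal_lt_one]
        exact hL₀ L hL N (card_boundaryBonds_cube_le d L)
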